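/- **Theorem 1.2.** Let $M$ be a connected two-dimensional $C^2$ manifold with boundary (Hausdorff and second countable; neither compactness nor orientability is assumed). Let $X: M\to\mathbb{R}^3$ be a minimal immersion of class $C^2$ up to and including $\partial M$: the differential of $X$ is injective at every point, and the mean curvature of $X$ vanishes at every interior point. Assume that $\Sigma=X(M)$ is not contained in a plane. Let $\Gamma$ be a connected component of $\partial M$ such that $X(\Gamma)$ is a circle (of positive radius). Suppose that there are a plane $\Pi$ containing $X(\Gamma)$ and a number $\theta$ such that, for every $p\in\Gamma$, the tangent plane $dX_p(T_pM)$ makes the angle $\theta$ with $\Pi$, where angles are understood up to orientation, that is, any nonzero normal vectors of the two planes make the angle $\theta$ or $\pi-\theta$. Then $\Sigma$ is part of a catenoid: there are a point $a\in\mathbb{R}^3$, a unit vector $m\in\mathbb{R}^3$ and a number $c>0$ such that every $x\in\Sigma$ satisfies $$\big|(x-a)-\langle x-a,m\rangle m\big| = c\,\cosh\!\Big(\frac{\langle x-a,m\rangle}{c}\Big).$$ -/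

import Mathlib

open scoped Manifold ContDiff

/-- Euclidean three-space. -/
abbrev E3 : Type := EuclideanSpace ℝ (Fin 3)

/-- The Euclidean parameter plane. -/
abbrev E2 : Type := EuclideanSpace ℝ (Fin 2)

/-- The cross product on Euclidean three-space. -/
noncomputable def cross (a b : E3) : E3 :=
  WithLp.toLp 2 (crossProduct a.ofLp b.ofLp)

/-- The partial derivative of `f` in the `i`-th coordinate direction. -/
noncomputable def pderiv (i : Fin 2) (f : E2 → E3) (z : E2) : E3 :=
  fderiv ℝ f z (EuclideanSpace.single i 1)

/-- Coefficients `E` (`0 0`), `F` (`0 1`), `G` (`1 1`) of the first fundamental form. -/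
noncomputable def firstFund (f : E2 → E3) (i j : Fin 2) (z : E2) : ℝ :=
  inner ℝ (pderiv i f z) (pderiv j f z)

/-- The unit normal `(f_u × f_v) / |f_u × f_v|` of a parametrized surface. -/
noncomputable def unitNormal (f : E2 → E3) (z : E2) : E3 :=
  ‖cross (pderiv 0 f z) (pderiv 1 f z)‖⁻¹ • cross (pderiv 0 f z) (pderiv 1 f z)

/-- Coefficients `L` (`0 0`), `M` (`0 1`), `N` (`1 1`) of the second fundamental form. -/
noncomputable def secondFund (f : E2 → E3) (i j : Fin 2) (z : E2) : ℝ :=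
  inner ℝ (pderiv i (pderiv j f) z) (unitNormal f z)

/-- The mean curvature `(E N - 2 F M + G L) / (2 (E G - F²))` of a parametrized surface. -/
noncomputable def meanCurvature (f : E2 → E3) (z : E2) : ℝ :=
  (firstFund f 0 0 z * secondFund f 1 1 z - 2 * (firstFund f 0 1 z * secondFund f 0 1 z)
      + firstFund f 1 1 z * secondFund f 0 0 z) /
    (2 * (firstFund f 0 0 z * firstFund f 1 1 z - firstFund f 0 1 z ^ 2))

/-- A map from a surface with boundary to three-space is a minimal immersion (of class `C²` up to
and including the boundary) if it is `C²`, its differential is injective at every point, boundary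
points included, and its mean curvature, computed in the charts of the `C²` structure, vanishes at
all interior points. -/
structure IsMinimalImmersion {M : Type*} [TopologicalSpace M]
    [ChartedSpace (EuclideanHalfSpace 2) M] (X : M → E3) : Prop where
  contMDiff : ContMDiff (𝓡∂ 2) 𝓘(ℝ, E3) 2 X
  injective_mfderiv : ∀ p : M, Function.Injective (mfderiv (𝓡∂ 2) 𝓘(ℝ, E3) X p)
  meanCurvature_eq_zero : ∀ e ∈ IsManifold.maximalAtlas (𝓡∂ 2) 2 M,
    ∀ z ∈ interior (e.extend (𝓡∂ 2)).target,
      meanCurvature (X ∘ (e.extend (𝓡∂ 2)).symm) z = 0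

/-- The tangent plane of the immersed surface `X` at the parameter point `p`, as a linear subspace
of three-space. -/
noncomputable def tangentPlane {M : Type*} [TopologicalSpace M]
    [ChartedSpace (EuclideanHalfSpace 2) M] (X : M → E3) (p : M) : Submodule ℝ E3 :=
  LinearMap.range (mfderiv (𝓡∂ 2) 𝓘(ℝ, E3) X p).toLinearMap

/-- `Γ` is a connected component of the boundary of the surface `M`. -/
def IsBoundaryComponent {M : Type*} [TopologicalSpace M]
    [ChartedSpace (EuclideanHalfSpace 2) M] (Γ : Set M) : Prop :=
  ∃ p ∈ (𝓡∂ 2).boundary M, Γ = connectedComponentIn ((𝓡∂ 2).boundary M) p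

/-- An affine plane in three-space. -/
def IsPlane (P : AffineSubspace ℝ E3) : Prop :=
  Module.finrank ℝ P.direction = 2

/-- A (round) circle in three-space, of positive radius. -/
def IsCircle (S : Set E3) : Prop :=
  ∃ P : AffineSubspace ℝ E3, IsPlane P ∧ ∃ c ∈ P, ∃ r : ℝ, 0 < r ∧ S = {x | x ∈ P ∧ dist x c = r}

/-- The two-dimensional subspaces `U`, `V` of three-space make the angle `θ` (up to the choice of
orientations, that is, up to replacing `θ` by `π - θ`): so do any nonzero vectors normal to `U`
and to `V`. -/
def MakeAngle (U V : Submodule ℝ E3) (θ : ℝ) : Prop :=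
  ∀ n ∈ Uᗮ, ∀ m ∈ Vᗮ, n ≠ 0 → m ≠ 0 →
    InnerProductGeometry.angle n m = θ ∨ InnerProductGeometry.angle n m = Real.pi - θ

/-- The catenoid with centre `a`, axis direction the unit vector `m`, and neck radius `c`: the
points whose distance to the axis is `c cosh (h / c)`, where `h` is the height along the axis. -/
def catenoid (a m : E3) (c : ℝ) : Set E3 :=
  {x | ‖(x - a) - inner ℝ (x - a) m • m‖ = c * Real.cosh (inner ℝ (x - a) m / c)}

/-- A set is a part of some catenoid. -/
def IsPartOfCatenoid (S : Set E3) : Prop :=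
  ∃ (a m : E3) (c : ℝ), ‖m‖ = 1 ∧ 0 < c ∧ S ⊆ catenoid a m c

open Set Filter Topology

/-! A minimal surface is determined near a boundary arc by the arc and by its tangent planes along
it. Here these data are those of a catenoid or of a plane, and the proof integrates them explicitly.

Minimality says that the one-form `N × df` is closed. On a half disc in a chart it has a primitive
`g`, the conjugate surface (`exists_isConjugate`), and every component `⟨a, f + i g⟩` is holomorphic
for the conformal structure of the surface. Such components also serve as local complex coordinates
with a derivative of class `C¹` up to the boundary, so isothermal parameters are not needed.

Put the centre of the circle at the origin and let `m` be the unit normal of its plane. Along the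
arc `⟨N, m⟩ = κ` is constant, hence so is `⟨N, f⟩ = μ`, with `μ² = r² (1 - κ²)`. Let `Z` be the
component of `f + i g` along `m`, let `A`, `B` be those along orthonormal horizontal vectors `e`,
`e' = m × e`, and put `P = A + iB`, `Q = A - iB`. For a suitable normalization of `g` the
derivatives along the arc are `Z' = iσμ`, `P' = iσP`, `Q' = -iσQ`. If `μ = 0`, then `Z` is constant
on the arc. Otherwise `P exp (-Z/μ)` and `Q exp (Z/μ)` are. A holomorphic function that vanishes on
the arc vanishes near it (`eq_zero_of_eq_zero_on_boundary`), so these relations hold near the arc.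
Their real parts say that the surface is planar there, or lies on a catenoid with waist `|μ|`
(`IsConjugate.planar_or_catenoid_of_centered`).

The boundary uniqueness uses no reflection: the function is multiplied by `exp (-n q)`, where `q` is
holomorphic with positive real part off the base point, and the maximum principle is applied as `n →
∞`. Finally the equations of planes and catenoids are analytic, so they propagate over the connected
surface (`IsMinimalImmersion.eq_zero_of_eventually_eq_zero`), and the planar case is excluded by
hypothesis. -/

/-! ### Vector algebra in three-space. -/

theorem inner_E3 (a b : E3) : inner ℝ a b = a 0 * b 0 + a 1 * b 1 + a 2 * b 2 := by
  simp [PiLp.inner_apply, Fin.sum_univ_three, mul_comm]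

theorem cross_apply_zero (a b : E3) : cross a b 0 = a 1 * b 2 - a 2 * b 1 := by
  simp [cross, crossProduct]

theorem cross_apply_one (a b : E3) : cross a b 1 = a 2 * b 0 - a 0 * b 2 := by
  simp [cross, crossProduct]

theorem cross_apply_two (a b : E3) : cross a b 2 = a 0 * b 1 - a 1 * b 0 := by
  simp [cross, crossProduct]

/-- The cross product as a continuous bilinear map. -/
noncomputable def crossL : E3 →L[ℝ] E3 →L[ℝ] E3 :=
  (LinearMap.mk₂ ℝ cross
    (fun a b c => by ext i; fin_cases i <;>
      simp [cross_apply_zero, cross_apply_one, cross_apply_two] <;> ring)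
    (fun r a b => by ext i; fin_cases i <;>
      simp [cross_apply_zero, cross_apply_one, cross_apply_two] <;> ring)
    (fun a b c => by ext i; fin_cases i <;>
      simp [cross_apply_zero, cross_apply_one, cross_apply_two] <;> ring)
    (fun r a b => by ext i; fin_cases i <;>
      simp [cross_apply_zero, cross_apply_one, cross_apply_two] <;> ring)).toContinuousBilinearMap

@[simp] theorem crossL_apply (a b : E3) : crossL a b = cross a b := rfl

theorem cross_add_left (a b c : E3) : cross (a + b) c = cross a c + cross b c := by
  simp [← crossL_apply]

theorem cross_add_right (a b c : E3) : cross a (b + c) = cross a b + cross a c := by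
  simp [← crossL_apply]

theorem cross_smul_left (r : ℝ) (a b : E3) : cross (r • a) b = r • cross a b := by
  simp [← crossL_apply]

theorem cross_smul_right (r : ℝ) (a b : E3) : cross a (r • b) = r • cross a b := by
  simp [← crossL_apply]

@[simp] theorem cross_zero_right (a : E3) : cross a 0 = 0 := by
  simp [← crossL_apply]

theorem cross_eq_neg_cross (a b : E3) : cross a b = -cross b a := by
  ext i; fin_cases i <;> simp [cross_apply_zero, cross_apply_one, cross_apply_two] <;> ring

@[simp] theorem cross_self_eq_zero (a : E3) : cross a a = 0 := by
  ext i; fin_cases i <;> simp [cross_apply_zero, cross_apply_one, cross_apply_two] <;> ring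

@[simp] theorem inner_left_cross (a b : E3) : inner ℝ a (cross a b) = 0 := by
  simp only [inner_E3, cross_apply_zero, cross_apply_one, cross_apply_two]; ring

@[simp] theorem inner_right_cross (a b : E3) : inner ℝ b (cross a b) = 0 := by
  simp only [inner_E3, cross_apply_zero, cross_apply_one, cross_apply_two]; ring

theorem inner_cross_cyclic (a b c : E3) : inner ℝ a (cross b c) = inner ℝ b (cross c a) := by
  simp only [inner_E3, cross_apply_zero, cross_apply_one, cross_apply_two]; ring

theorem inner_cross_swap (a b c : E3) : inner ℝ a (cross b c) = -inner ℝ a (cross c b) := by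
  simp only [inner_E3, cross_apply_zero, cross_apply_one, cross_apply_two]; ring

theorem cross_cross_eq (a b c : E3) :
    cross a (cross b c) = (inner ℝ a c : ℝ) • b - (inner ℝ a b : ℝ) • c := by
  ext i; fin_cases i <;>
    simp [inner_E3, cross_apply_zero, cross_apply_one, cross_apply_two] <;> ring

theorem inner_cross_cross (a b c d : E3) : inner ℝ (cross a b) (cross c d) =
    (inner ℝ a c * inner ℝ b d - inner ℝ a d * inner ℝ b c : ℝ) := by
  simp only [inner_E3, cross_apply_zero, cross_apply_one, cross_apply_two]; ring

/-- A vector orthogonal to both factors is a multiple of the cross product direction. -/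
theorem norm_sq_smul_eq_of_orthogonal {a b v : E3} (ha : inner ℝ a v = (0 : ℝ))
    (hb : inner ℝ b v = (0 : ℝ)) :
    (inner ℝ (cross a b) (cross a b) : ℝ) • v = (inner ℝ (cross a b) v : ℝ) • cross a b := by
  have h := cross_cross_eq (cross a b) v (cross a b)
  rw [cross_cross_eq v a b, real_inner_comm b v, hb, real_inner_comm a v, ha] at h
  simp only [zero_smul, sub_zero, cross_zero_right] at h
  exact (sub_eq_zero.mp h.symm)

theorem eq_zero_of_orthogonal {a b v : E3} (hab : cross a b ≠ 0) (ha : inner ℝ a v = (0 : ℝ))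
    (hb : inner ℝ b v = (0 : ℝ)) (h : inner ℝ (cross a b) v = (0 : ℝ)) : v = 0 := by
  have := norm_sq_smul_eq_of_orthogonal ha hb
  rw [h, zero_smul, smul_eq_zero] at this
  exact this.resolve_left (inner_self_ne_zero.mpr hab)

theorem cross_ne_zero_of_injective {A : E2 →L[ℝ] E3} (hA : Function.Injective A) {x y : E2}
    (hxy : LinearIndependent ℝ ![x, y]) : cross (A x) (A y) ≠ 0 := by
  intro h
  have h1 := cross_cross_eq (A y) (A x) (A y)
  rw [h, cross_zero_right, ← map_smul, ← map_smul, ← map_sub] at h1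
  have h2 := hA (h1.symm.trans (map_zero A).symm)
  rw [LinearIndependent.pair_iff] at hxy
  have h3 := (hxy (inner ℝ (A y) (A y)) (-inner ℝ (A y) (A x)) (by rw [neg_smul, ← sub_eq_add_neg]; exact h2)).1
  rw [inner_self_eq_zero] at h3
  have h4 : y = 0 := hA (h3.trans (map_zero A).symm)
  simpa [h4] using (hxy 0 1 (by simp [h4])).2

/-- Decomposition of a tangent vector in the frame `t`, `n × t`. -/
theorem norm_sq_smul_eq_frame {n s t : E3} (hn : inner ℝ n n = (1 : ℝ))
    (hs : inner ℝ n s = (0 : ℝ)) (ht : inner ℝ n t = (0 : ℝ)) :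
    (inner ℝ s s : ℝ) • t = (inner ℝ s t : ℝ) • s + (inner ℝ (cross n s) t : ℝ) • cross n s := by
  have h1 : inner ℝ (cross n s) (cross n s) = (inner ℝ s s : ℝ) := by
    rw [inner_cross_cross, hn, real_inner_comm n s, hs]; simp
  have h := cross_cross_eq s t s
  have h2 : cross t s = (inner ℝ n (cross t s) : ℝ) • n := by
    have h3 := cross_cross_eq n (cross t s) n
    rw [cross_eq_neg_cross (cross t s) n, cross_cross_eq n t s, hs, ht, hn] at h3
    simp only [zero_smul, sub_zero, neg_zero, cross_zero_right, one_smul] at h3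
    exact (sub_eq_zero.mp h3.symm)
  rw [h2, cross_smul_right, cross_eq_neg_cross s n] at h
  have h4 : inner ℝ n (cross t s) = (-inner ℝ (cross n s) t : ℝ) := by
    rw [inner_cross_cyclic, inner_cross_swap, real_inner_comm]
  rw [h4] at h
  have h5 : (inner ℝ s s : ℝ) • t = (inner ℝ s t : ℝ) • s +
    ((inner ℝ s s : ℝ) • t - (inner ℝ s t : ℝ) • s) := by abel
  rw [h5, ← h]; simp

/-- Vanishing mean curvature in terms of the derivatives `p`, `q` of the unit normal `n` in the
directions with tangent vectors `a`, `b`. -/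
theorem cross_eq_cross_of_mean_zero {n a b p q : E3} {w : ℝ} (hw : w ≠ 0)
    (hab : cross a b = w • n) (hn : n ≠ 0)
    (hp : inner ℝ n p = (0 : ℝ)) (hq : inner ℝ n q = (0 : ℝ))
    (hpq : inner ℝ p b = (inner ℝ q a : ℝ))
    (hH : (inner ℝ a a * inner ℝ q b - 2 * (inner ℝ a b * inner ℝ p b)
      + inner ℝ b b * inner ℝ p a : ℝ) = 0) :
    cross q a = cross p b := by
  have hab0 : cross a b ≠ 0 := by rw [hab]; exact smul_ne_zero hw hn
  have hp' : inner ℝ p (cross a b) = (0 : ℝ) := by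
    rw [hab, inner_smul_right, real_inner_comm, hp, mul_zero]
  have hq' : inner ℝ q (cross a b) = (0 : ℝ) := by
    rw [hab, inner_smul_right, real_inner_comm, hq, mul_zero]
  rw [← sub_eq_zero]
  apply eq_zero_of_orthogonal hab0
  -- The difference has no tangential part because `p` and `q` are tangent; by Lagrange's identity
  -- its normal part is the numerator of the mean curvature.
  · rw [inner_sub_right, inner_right_cross, inner_cross_cyclic, inner_cross_swap, hp']; simp
  · rw [inner_sub_right, inner_right_cross, inner_cross_cyclic, hq']; simp
  · rw [inner_sub_right, inner_cross_cross, inner_cross_cross]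
    rw [real_inner_comm q a, real_inner_comm q b, real_inner_comm p a, real_inner_comm p b, real_inner_comm a b]
    simp only [real_inner_comm] at hH hpq ⊢
    linear_combination (-(inner ℝ a b : ℝ)) * hpq - hH

/-! ### Functions holomorphic relative to a complex coordinate, and the maximum principle. -/

/-- `g` is holomorphic at `z` with respect to the complex coordinate with differential `ζ'`. -/
def HolomorphicRel (ζ' : E2 → E2 →L[ℝ] ℂ) (g : E2 → ℂ) (z : E2) : Prop :=
  ∃ c : ℂ, HasFDerivAt g (c • ζ' z) z

theorem HolomorphicRel.comp {ζ' : E2 → E2 →L[ℝ] ℂ} {g : E2 → ℂ} {z : E2} {h : ℂ → ℂ}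
    (hg : HolomorphicRel ζ' g z) (hh : DifferentiableAt ℂ h (g z)) :
    HolomorphicRel ζ' (fun w => h (g w)) z := by
  obtain ⟨c, hc⟩ := hg
  refine ⟨deriv h (g z) * c, ?_⟩
  have := (hh.hasDerivAt.hasFDerivAt.restrictScalars ℝ).comp z hc
  convert! this using 1
  ext v
  simp [mul_comm, mul_left_comm, mul_assoc]

theorem HolomorphicRel.add {ζ' : E2 → E2 →L[ℝ] ℂ} {g h : E2 → ℂ} {z : E2}
    (hg : HolomorphicRel ζ' g z) (hh : HolomorphicRel ζ' h z) :
    HolomorphicRel ζ' (fun w => g w + h w) z := by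
  obtain ⟨c, hc⟩ := hg
  obtain ⟨d, hd⟩ := hh
  exact ⟨c + d, (hc.add hd).congr_fderiv (by ext v; simp; ring)⟩

theorem HolomorphicRel.mul {ζ' : E2 → E2 →L[ℝ] ℂ} {g h : E2 → ℂ} {z : E2}
    (hg : HolomorphicRel ζ' g z) (hh : HolomorphicRel ζ' h z) :
    HolomorphicRel ζ' (fun w => g w * h w) z := by
  obtain ⟨c, hc⟩ := hg
  obtain ⟨d, hd⟩ := hh
  refine ⟨g z * d + h z * c, ?_⟩
  convert! hc.mul hd using 1
  ext v
  simp; ring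

/-- A continuously differentiable complex coordinate with injective differential can be inverted
locally, and turns relatively holomorphic functions into holomorphic ones. -/
theorem exists_local_inverse {ζ : E2 → ℂ} {ζ' : E2 → E2 →L[ℝ] ℂ} {z₀ : E2}
    (hζ : ∀ᶠ z in 𝓝 z₀, HasFDerivAt ζ (ζ' z) z) (hc : ContinuousAt ζ' z₀)
    (hinj : ∀ᶠ z in 𝓝 z₀, Function.Injective (ζ' z)) :
    ∃ φ : ℂ → E2, (∀ᶠ y in 𝓝 (ζ z₀), ContinuousAt φ y) ∧ φ (ζ z₀) = z₀ ∧ (∀ᶠ z in 𝓝 z₀, φ (ζ z) = z) ∧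
      ∀ g : E2 → ℂ, (∀ᶠ z in 𝓝 z₀, HolomorphicRel ζ' g z) →
        ∀ᶠ y in 𝓝 (ζ z₀), DifferentiableAt ℂ (g ∘ φ) y := by
  have hdim : Module.finrank ℝ E2 = Module.finrank ℝ ℂ := by simp
  have heq : ∀ z, Function.Injective (ζ' z) → ∃ L : E2 ≃L[ℝ] ℂ, (L : E2 →L[ℝ] ℂ) = ζ' z := by
    intro z hz
    refine ⟨(LinearEquiv.ofInjectiveOfFinrankEq (ζ' z).toLinearMap hz hdim).toContinuousLinearEquiv,
      ?_⟩
    ext v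
    exact congrArg (fun A : E2 →ₗ[ℝ] ℂ => A v)
      (LinearEquiv.coe_ofInjectiveOfFinrankEq (ζ' z).toLinearMap hz hdim)
  obtain ⟨L, hL⟩ := heq z₀ hinj.self_of_nhds
  have hs : HasStrictFDerivAt ζ (L : E2 →L[ℝ] ℂ) z₀ := by
    rw [hL]; exact hasStrictFDerivAt_of_hasFDerivAt_of_continuousAt hζ hc
  set Φ := hs.toOpenPartialHomeomorph ζ with hΦ
  have hmem : z₀ ∈ Φ.source := hs.mem_toOpenPartialHomeomorph_source
  have hmemt : ζ z₀ ∈ Φ.target := Φ.map_source hmem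
  have hφ0 : Φ.symm (ζ z₀) = z₀ := Φ.left_inv hmem
  have hφc : ContinuousAt Φ.symm (ζ z₀) := Φ.symm.continuousAt hmemt
  refine ⟨Φ.symm, eventually_of_mem (Φ.open_target.mem_nhds hmemt)
    (fun y hy => Φ.symm.continuousAt hy), hφ0, ?_, ?_⟩
  · filter_upwards [Φ.open_source.mem_nhds hmem] with z hz using Φ.left_inv hz
  · intro g hg
    have ht : Tendsto Φ.symm (𝓝 (ζ z₀)) (𝓝 z₀) := by simpa [ContinuousAt, hφ0] using hφc
    filter_upwards [ht.eventually hg, ht.eventually hζ, ht.eventually hinj,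
      Φ.open_target.mem_nhds hmemt] with y h1 h2 h3 h4
    obtain ⟨c, h1⟩ := h1
    obtain ⟨A, hA⟩ := heq _ h3
    rw [← hA] at h1 h2
    have h5 : HasFDerivAt Φ.symm (A.symm : ℂ →L[ℝ] E2) y := Φ.hasFDerivAt_symm h4 h2
    have h6 := h1.comp y h5
    -- The real derivative is `c • ζ'` composed with the inverse of `ζ'`, that is, multiplication by
    -- `c`.
    have h7 : HasDerivAt (g ∘ Φ.symm) c y := by
      rw [hasDerivAt_iff_hasFDerivAt]
      refine hasFDerivAt_of_restrictScalars ℝ h6 ?_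
      ext v; simp [mul_comm]
    exact h7.differentiableAt

/-- The local inverse of the coordinate carries this over to the maximum modulus principle in the
complex plane. -/
theorem eventually_eq_of_isLocalMax_norm_rel {ζ : E2 → ℂ} {ζ' : E2 → E2 →L[ℝ] ℂ} {z₀ : E2}
    (hζ : ∀ᶠ z in 𝓝 z₀, HasFDerivAt ζ (ζ' z) z) (hc : ContinuousAt ζ' z₀)
    (hinj : ∀ᶠ z in 𝓝 z₀, Function.Injective (ζ' z)) {g : E2 → ℂ}
    (hg : ∀ᶠ z in 𝓝 z₀, HolomorphicRel ζ' g z) (hmax : ∀ᶠ z in 𝓝 z₀, ‖g z‖ ≤ ‖g z₀‖) :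
    ∀ᶠ z in 𝓝 z₀, g z = g z₀ := by
  obtain ⟨φ, hφc, hφ0, hφ, hd⟩ := exists_local_inverse hζ hc hinj
  have ht : Tendsto φ (𝓝 (ζ z₀)) (𝓝 z₀) := by
    simpa [ContinuousAt, hφ0] using hφc.self_of_nhds
  have h1 := Complex.eventually_eq_of_isLocalMax_norm (f := g ∘ φ) (hd g hg) (by
    filter_upwards [ht.eventually hmax] with y hy
    simpa [hφ0] using hy)
  filter_upwards [hφ, hζ.self_of_nhds.continuousAt.eventually h1] with z h2 h3
  simpa [h2, hφ0] using h3

/-- The maximum principle for relatively holomorphic functions. -/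
theorem norm_le_of_forall_boundary_norm_le {ζ : E2 → ℂ} {ζ' : E2 → E2 →L[ℝ] ℂ} {U K : Set E2}
    (hU : IsOpen U) (hUc : IsPreconnected U) (hK : IsCompact K) (hUK : U ⊆ K)
    (hKU : K ⊆ closure U) (hne : (K \ U).Nonempty)
    (hζ : ∀ z ∈ U, HasFDerivAt ζ (ζ' z) z) (hc : ContinuousOn ζ' U)
    (hinj : ∀ z ∈ U, Function.Injective (ζ' z)) {g : E2 → ℂ} (hgc : ContinuousOn g K)
    (hg : ∀ z ∈ U, HolomorphicRel ζ' g z) {C : ℝ} (hC : ∀ z ∈ K \ U, ‖g z‖ ≤ C)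
    {z : E2} (hz : z ∈ K) : ‖g z‖ ≤ C := by
  obtain ⟨w, hwK, hw⟩ := hK.exists_isMaxOn ⟨z, hz⟩ hgc.norm
  refine (hw hz).trans ?_
  by_cases hwU : w ∈ U
  swap
  · exact hC w ⟨hwK, hwU⟩
  -- If the maximum is attained inside, the set where `g = g w` is open and relatively closed in
  -- `U`; `g` is then constant on `K`, and a point of `K \ U` gives the bound.
  have key : ∀ y ∈ U, g y = g w → ∀ᶠ x in 𝓝 y, g x = g w := by
    intro y hy hyw
    have hn := hU.mem_nhds hy
    have := eventually_eq_of_isLocalMax_norm_rel (eventually_of_mem hn hζ) (hc.continuousAt hn)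
      (eventually_of_mem hn hinj) (eventually_of_mem hn hg)
      (eventually_of_mem hn fun x hx => by rw [hyw]; exact hw (hUK hx))
    rwa [hyw] at this
  have hsub : U ⊆ interior {y | g y = g w} := by
    refine hUc.subset_of_closure_inter_subset isOpen_interior
      ⟨w, hwU, mem_interior_iff_mem_nhds.mpr (key w hwU rfl)⟩ ?_
    rintro y ⟨hy1, hy2⟩
    refine mem_interior_iff_mem_nhds.mpr (key y hy2 ?_)
    have hcy : ContinuousAt g y := (hgc.mono hUK).continuousAt (hU.mem_nhds hy2)
    by_contra hne
    have h1 : ∀ᶠ x in 𝓝 y, g x ≠ g w := hcy.eventually_ne hne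
    obtain ⟨x, hx1, hx2⟩ := (mem_closure_iff_nhds.mp hy1) _ h1
    exact hx1 (interior_subset (s := {y | g y = g w}) hx2)
  obtain ⟨x, hx⟩ := hne
  have : EqOn g (fun _ => g w) K := EqOn.of_subset_closure (s := U)
    (fun y hy => interior_subset (s := {y | g y = g w}) (hsub hy)) hgc continuousOn_const hUK hKU
  show ‖g w‖ ≤ C
  have h := hC x hx
  rwa [this hx.1] at h

/-! ### Boundary uniqueness on half discs. -/

/-- With `x + i y` the increment of the coordinate, the last expression is the real part of `ζ - K
ζ²`. The boundary is curved in the coordinate, so `x` may be as low as `-C u²` there; since `y ≈ β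
u` on the boundary, the term `K y²` compensates. -/
theorem exists_quadratic_barrier {α β γ C : ℝ} (hα : 0 < α) (hβ : β ≠ 0) (hC : 0 ≤ C) :
    ∃ K ρ : ℝ, 0 < ρ ∧ ∀ u v x y : ℝ, 0 ≤ v → 0 < u ^ 2 + v ^ 2 → u ^ 2 + v ^ 2 ≤ ρ ^ 2 →
      |x - α * v| ≤ C * (u ^ 2 + v ^ 2) → |y - γ * v - β * u| ≤ C * (u ^ 2 + v ^ 2) →
      0 < x - K * (x ^ 2 - y ^ 2) := by
  have hβ2 : 0 < β ^ 2 := by positivity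
  -- Half of `K β² u²` survives the cross terms of `y²`; this choice makes it `(C + 1) u²`, which
  -- beats the error `C u²` and leaves `u²` to spare.
  obtain ⟨K, hK0, hK⟩ : ∃ K : ℝ, 0 ≤ K ∧ K * β ^ 2 = 2 * (C + 1) :=
    ⟨2 * (C + 1) / β ^ 2, by positivity, by field_simp⟩
  set A := C + K * (2 * α ^ 2 + 2 * γ ^ 2) + 1 with hA
  have hA0 : 0 < A := by positivity
  set B := 4 * K * C ^ 2 with hB
  have hB0 : 0 ≤ B := by positivity
  -- The radius is small enough that the quartic errors `B s²` are at most `s / 2` and the errors `A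
  -- v²` at most half of `α v`.
  refine ⟨K, min 1 (min (1 / (2 * B + 1)) (α / (2 * A))), by positivity, ?_⟩
  set ρ := min 1 (min (1 / (2 * B + 1)) (α / (2 * A))) with hρ
  have hρ0 : 0 < ρ := by positivity
  have hρ1 : ρ ≤ 1 := min_le_left _ _
  have hρB : ρ * (2 * B + 1) ≤ 1 := by
    rw [← le_div_iff₀ (by positivity)]; exact (min_le_right _ _).trans (min_le_left _ _)
  have hρA : ρ * (2 * A) ≤ α := by
    rw [← le_div_iff₀ (by positivity)]; exact (min_le_right _ _).trans (min_le_right _ _)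
  intro u v x y hv hs0 hs hx hy
  set s := u ^ 2 + v ^ 2 with hsdef
  have hv1 : v ≤ ρ := by
    refine (abs_le_of_sq_le_sq' ?_ hρ0.le).2
    linarith [sq_nonneg u]
  obtain ⟨e, he⟩ : ∃ e, e = x - α * v := ⟨_, rfl⟩
  obtain ⟨d, hd⟩ : ∃ d, d = y - γ * v - β * u := ⟨_, rfl⟩
  rw [← he] at hx
  rw [← hd] at hy
  have hCs : 0 ≤ C * s := by positivity
  have he2 : e ^ 2 ≤ C ^ 2 * s ^ 2 := by
    rw [← mul_pow]; exact sq_le_sq' (abs_le.mp hx).1 (abs_le.mp hx).2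
  have hd2 : d ^ 2 ≤ C ^ 2 * s ^ 2 := by
    rw [← mul_pow]; exact sq_le_sq' (abs_le.mp hy).1 (abs_le.mp hy).2
  have hx2 : x ^ 2 ≤ 2 * α ^ 2 * v ^ 2 + 2 * (C ^ 2 * s ^ 2) := by
    have : x = α * v + e := by rw [he]; ring
    rw [this]; nlinarith [sq_nonneg (α * v - e)]
  have hy2 : β ^ 2 * u ^ 2 / 2 - 2 * γ ^ 2 * v ^ 2 - 2 * (C ^ 2 * s ^ 2) ≤ y ^ 2 := by
    have : y = β * u + (γ * v + d) := by rw [hd]; ring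
    rw [this]
    nlinarith [sq_nonneg (β * u + 2 * (γ * v + d)), sq_nonneg (γ * v - d)]
  have hx1 : α * v - C * s ≤ x := by have := (abs_le.mp hx).1; linarith
  have h1 : K * (x ^ 2 - y ^ 2) ≤ K * (2 * α ^ 2 * v ^ 2 + 2 * (C ^ 2 * s ^ 2)
      - (β ^ 2 * u ^ 2 / 2 - 2 * γ ^ 2 * v ^ 2 - 2 * (C ^ 2 * s ^ 2))) :=
    mul_le_mul_of_nonneg_left (by linarith) hK0
  have h2 : K * (2 * α ^ 2 * v ^ 2 + 2 * (C ^ 2 * s ^ 2)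
      - (β ^ 2 * u ^ 2 / 2 - 2 * γ ^ 2 * v ^ 2 - 2 * (C ^ 2 * s ^ 2)))
      = (A - C - 1) * v ^ 2 + B * s ^ 2 - (C + 1) * u ^ 2 := by
    rw [hA, hB]; linear_combination (-(u ^ 2) / 2) * hK
  have h3 : B * s ^ 2 ≤ s / 2 := by
    have h31 : s ≤ ρ := hs.trans (by rw [sq]; exact mul_le_of_le_one_left hρ0.le hρ1)
    have h32 : B * s ≤ B * ρ := mul_le_mul_of_nonneg_left h31 hB0
    have h33 : B * s ≤ 1 / 2 := by linarith
    calc B * s ^ 2 = (B * s) * s := by ring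
      _ ≤ 1 / 2 * s := mul_le_mul_of_nonneg_right h33 hs0.le
      _ = s / 2 := by ring
  have h4 : A * v ^ 2 ≤ α * v / 2 := by
    have h41 : A * v ≤ A * ρ := mul_le_mul_of_nonneg_left hv1 hA0.le
    have h42 : A * v ≤ α / 2 := by linarith
    calc A * v ^ 2 = (A * v) * v := by ring
      _ ≤ α / 2 * v := mul_le_mul_of_nonneg_right h42 hv
      _ = α * v / 2 := by ring
  have h5 : 0 < α * v / 2 + u ^ 2 / 2 := by
    rcases hv.eq_or_lt with h | h
    · have : 0 < u ^ 2 := by rw [hsdef, ← h] at hs0; linarith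
      rw [← h]; linarith
    · positivity
  have : C * s = C * u ^ 2 + C * v ^ 2 := by rw [hsdef]; ring
  have h6 : s = u ^ 2 + v ^ 2 := hsdef
  rw [h2] at h1
  have h7 : (A - C - 1) * v ^ 2 = A * v ^ 2 - C * v ^ 2 - v ^ 2 := by ring
  have h8 : (C + 1) * u ^ 2 = C * u ^ 2 + u ^ 2 := by ring
  linarith [sq_nonneg v]

/-- The part of a disc that lies in the closed upper half plane. -/
def halfBall (z : E2) (r : ℝ) : Set E2 := Metric.ball z r ∩ {w | 0 ≤ w 0}

theorem convex_halfPlane : Convex ℝ {w : E2 | 0 ≤ w 0} := by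
  intro x hx y hy a b ha hb _
  simp only [mem_ofPred_eq, PiLp.add_apply, PiLp.smul_apply, smul_eq_mul] at *
  positivity

theorem convex_openHalfPlane : Convex ℝ {w : E2 | 0 < w 0} :=
  convex_halfSpace_gt (f := fun w : E2 => w 0) ⟨fun _ _ => rfl, fun _ _ => rfl⟩ 0

theorem isClosed_halfPlane : IsClosed {w : E2 | 0 ≤ w 0} :=
  isClosed_le continuous_const (by fun_prop)

theorem isOpen_openHalfPlane : IsOpen {w : E2 | 0 < w 0} :=
  isOpen_lt continuous_const (by fun_prop)

theorem convex_halfBall (z : E2) (r : ℝ) : Convex ℝ (halfBall z r) :=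
  (convex_ball z r).inter convex_halfPlane

theorem interior_halfPlane : interior {w : E2 | 0 ≤ w 0} = {w : E2 | 0 < w 0} := by
  rw [← range_modelWithCornersEuclideanHalfSpace 2,
    interior_range_modelWithCornersEuclideanHalfSpace]

theorem interior_halfBall (z : E2) (r : ℝ) :
    interior (halfBall z r) = Metric.ball z r ∩ {w | 0 < w 0} := by
  rw [halfBall, interior_inter, Metric.isOpen_ball.interior_eq, interior_halfPlane]

theorem halfBall_mono {z : E2} {r s : ℝ} (h : r ≤ s) : halfBall z r ⊆ halfBall z s :=
  inter_subset_inter_left _ (Metric.ball_subset_ball h)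

theorem mem_halfBall_self {z : E2} {r : ℝ} (hz : 0 ≤ z 0) (hr : 0 < r) : z ∈ halfBall z r :=
  ⟨Metric.mem_ball_self hr, hz⟩

theorem norm_sub_sq_eq (w z : E2) : ‖w - z‖ ^ 2 = (w 1 - z 1) ^ 2 + (w 0 - z 0) ^ 2 := by
  rw [EuclideanSpace.norm_sq_eq, Fin.sum_univ_two]
  simp [add_comm]

theorem E2_eq_sum (w : E2) :
    w = w 0 • EuclideanSpace.single 0 1 + w 1 • EuclideanSpace.single 1 1 := by
  ext i; fin_cases i <;> simp

theorem add_smul_single_mem_ball {z : E2} {r t : ℝ} (ht : 0 ≤ t) (htr : t < r) :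
    z + t • EuclideanSpace.single 0 1 ∈ Metric.ball z r := by
  rw [mem_ball_iff_norm]
  simp [norm_smul, abs_of_nonneg ht, htr]

theorem nonempty_interior_halfBall {z : E2} {r : ℝ} (hz : 0 ≤ z 0) (hr : 0 < r) :
    (interior (halfBall z r)).Nonempty := by
  rw [interior_halfBall]
  refine ⟨z + (r / 2) • EuclideanSpace.single 0 1,
    add_smul_single_mem_ball (by positivity) (by linarith), ?_⟩
  simp only [mem_ofPred_eq, PiLp.add_apply, PiLp.smul_apply, PiLp.single_apply]
  simp; linarith

theorem exists_halfBall_subset_of_eventually {z : E2} {R : ℝ} (hR : 0 < R) {p : E2 → Prop}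
    (h : ∀ᶠ w in 𝓝[halfBall z R] z, p w) :
    ∃ r, 0 < r ∧ r ≤ R ∧ ∀ w ∈ halfBall z r, p w := by
  rw [eventually_nhdsWithin_iff, Metric.eventually_nhds_iff_ball] at h
  obtain ⟨ε, hε, h⟩ := h
  refine ⟨min ε R, lt_min hε hR, min_le_right _ _, fun w hw => h w ?_ ?_⟩
  · exact (halfBall_mono (min_le_left _ _) hw).1
  · exact halfBall_mono (min_le_right _ _) hw

/-- Second order Taylor estimate at a boundary point. -/
theorem exists_norm_sub_le_sq {z₀ : E2} (hz₀ : 0 ≤ z₀ 0) {R : ℝ} (hR : 0 < R)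
    {ζ : E2 → ℂ} {ζ' : E2 → E2 →L[ℝ] ℂ}
    (hζ : ∀ z ∈ halfBall z₀ R, HasFDerivWithinAt ζ (ζ' z) (halfBall z₀ R) z)
    (hd : DifferentiableWithinAt ℝ ζ' (halfBall z₀ R) z₀) :
    ∃ C r : ℝ, 0 ≤ C ∧ 0 < r ∧ r ≤ R ∧
      ∀ w ∈ halfBall z₀ r, ‖ζ w - ζ z₀ - ζ' z₀ (w - z₀)‖ ≤ C * ‖w - z₀‖ ^ 2 := by
  obtain ⟨C, hC0, hC⟩ := hd.isBigO_sub.exists_nonneg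
  obtain ⟨r, hr, hrR, h⟩ := exists_halfBall_subset_of_eventually hR hC.bound
  refine ⟨C, r, hC0, hr, hrR, fun w hw => ?_⟩
  -- On this convex set the derivative differs from `ζ' z₀` by at most `C ‖w - z₀‖`, so the mean
  -- value inequality yields the square.
  set T := Metric.closedBall z₀ ‖w - z₀‖ ∩ {w : E2 | 0 ≤ w 0} with hT
  have hTr : T ⊆ halfBall z₀ r := by
    rintro y ⟨hy1, hy2⟩
    refine ⟨?_, hy2⟩
    have := hw.1
    rw [mem_ball_iff_norm] at this ⊢
    rw [mem_closedBall_iff_norm] at hy1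
    exact hy1.trans_lt this
  have hconv : Convex ℝ T := (convex_closedBall _ _).inter convex_halfPlane
  have := hconv.norm_image_sub_le_of_norm_hasFDerivWithin_le' (f := ζ) (f' := ζ') (φ := ζ' z₀)
    (C := C * ‖w - z₀‖) (x := z₀) (y := w)
    (fun y hy => (hζ y (halfBall_mono hrR (hTr hy))).mono (hTr.trans (halfBall_mono hrR)))
    (fun y hy => (h y (hTr hy)).trans
      (mul_le_mul_of_nonneg_left (mem_closedBall_iff_norm.mp hy.1) hC0))
    ⟨by simp, hz₀⟩ ⟨by simp [dist_eq_norm], hw.2⟩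
  rw [sq, ← mul_assoc]
  exact this

/-- A function on a half disc that is holomorphic with respect to a complex coordinate of class
`C²` up to the boundary, and vanishes on the boundary, vanishes near the centre. -/
theorem eq_zero_of_eq_zero_on_boundary {z₀ : E2} (hz₀ : z₀ 0 = 0) {R : ℝ} (hR : 0 < R)
    {ζ : E2 → ℂ} {ζ' : E2 → E2 →L[ℝ] ℂ}
    (hζ : ∀ z ∈ halfBall z₀ R, HasFDerivWithinAt ζ (ζ' z) (halfBall z₀ R) z)
    (hd : DifferentiableWithinAt ℝ ζ' (halfBall z₀ R) z₀)
    (hc : ContinuousOn ζ' (halfBall z₀ R))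
    (hinj : ∀ z ∈ interior (halfBall z₀ R), Function.Injective (ζ' z))
    (h0 : 0 < (ζ' z₀ (EuclideanSpace.single 0 1)).re)
    (h1 : (ζ' z₀ (EuclideanSpace.single 1 1)).re = 0)
    (h1' : (ζ' z₀ (EuclideanSpace.single 1 1)).im ≠ 0)
    {g : E2 → ℂ} (hgc : ContinuousOn g (halfBall z₀ R))
    (hg : ∀ z ∈ interior (halfBall z₀ R), HolomorphicRel ζ' g z)
    (hg0 : ∀ z ∈ halfBall z₀ R, z 0 = 0 → g z = 0) :
    ∃ r, 0 < r ∧ r ≤ R ∧ ∀ z ∈ halfBall z₀ r, g z = 0 := by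
  obtain ⟨C, r₁, hC, hr₁, hr₁R, hT⟩ := exists_norm_sub_le_sq hz₀.ge hR hζ hd
  obtain ⟨K, ρ, hρ, hK⟩ := exists_quadratic_barrier (γ := (ζ' z₀ (EuclideanSpace.single 0 1)).im)
    h0 h1' hC
  -- The barrier: it vanishes at `z₀`, and its real part is positive at the other nearby points of
  -- the closed half disc.
  set q : E2 → ℂ := fun z => (ζ z - ζ z₀) + (-K : ℂ) * ((ζ z - ζ z₀) * (ζ z - ζ z₀)) with hq
  have hζc : ContinuousOn ζ (halfBall z₀ R) := fun z hz => (hζ z hz).continuousWithinAt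
  have hqc : ContinuousOn q (halfBall z₀ R) := by fun_prop
  have hqpos : ∀ w ∈ halfBall z₀ r₁, w ≠ z₀ → ‖w - z₀‖ ≤ ρ → 0 < (q w).re := by
    intro w hw hne hwρ
    have hnorm := norm_sub_sq_eq w z₀
    rw [hz₀, sub_zero] at hnorm
    have hlin : ζ' z₀ (w - z₀) = w 0 • ζ' z₀ (EuclideanSpace.single 0 1)
        + (w 1 - z₀ 1) • ζ' z₀ (EuclideanSpace.single 1 1) := by
      conv_lhs => rw [E2_eq_sum (w - z₀)]
      simp [hz₀]
    have hTw := hT w hw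
    rw [hlin] at hTw
    have hre := (Complex.abs_re_le_norm _).trans hTw
    have him := (Complex.abs_im_le_norm _).trans hTw
    rw [hnorm] at hre him
    have hpos : 0 < ‖w - z₀‖ := norm_pos_iff.mpr (sub_ne_zero.mpr hne)
    have := hK (w 1 - z₀ 1) (w 0) (ζ w - ζ z₀).re (ζ w - ζ z₀).im hw.2
      (by rw [← hnorm]; positivity) (by rw [← hnorm]; gcongr)
      (le_of_eq_of_le (congrArg abs (by simp [h1]; ring)) hre)
      (le_of_eq_of_le (congrArg abs (by simp; ring)) him)
    convert this using 1
    simp [hq]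
    ring
  set r₂ := min r₁ ρ / 2 with hr₂
  have hm : 0 < min r₁ ρ := lt_min hr₁ hρ
  have hr₂0 : 0 < r₂ := by positivity
  have hr₂1 : r₂ < r₁ := by linarith [min_le_left r₁ ρ]
  have hr₂ρ : r₂ ≤ ρ := by linarith [min_le_right r₁ ρ]
  set D := Metric.closedBall z₀ r₂ ∩ {w : E2 | 0 ≤ w 0} with hD
  set U := Metric.ball z₀ r₂ ∩ {w : E2 | 0 < w 0} with hU
  have hDS : D ⊆ halfBall z₀ R := fun w hw =>
    ⟨Metric.closedBall_subset_ball (hr₂1.trans_le hr₁R) hw.1, hw.2⟩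
  have hDS1 : D ⊆ halfBall z₀ r₁ := fun w hw =>
    ⟨Metric.closedBall_subset_ball hr₂1 hw.1, hw.2⟩
  have hUS : U ⊆ interior (halfBall z₀ R) := by
    rw [interior_halfBall]
    exact inter_subset_inter_left _ (Metric.ball_subset_ball (hr₂1.le.trans hr₁R))
  have hUo : IsOpen U := Metric.isOpen_ball.inter isOpen_openHalfPlane
  have hUD : U ⊆ D := fun w hw => ⟨Metric.ball_subset_closedBall hw.1, (show 0 < w 0 from hw.2).le⟩
  have hDc : IsCompact D := (isCompact_closedBall _ _).inter_right isClosed_halfPlane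
  have hDU : D ⊆ closure U := by
    have hconv : Convex ℝ D := (convex_closedBall _ _).inter convex_halfPlane
    have hUint : interior D ⊆ U := by
      rw [hD, interior_inter, interior_halfPlane, interior_closedBall _ hr₂0.ne']
    have hne : (interior D).Nonempty := by
      obtain ⟨x, hx⟩ := nonempty_interior_halfBall (z := z₀) hz₀.ge hr₂0
      rw [interior_halfBall] at hx
      exact ⟨x, interior_maximal hUD hUo hx⟩
    have := hconv.closure_interior_eq_closure_of_nonempty_interior hne
    exact (subset_closure.trans this.ge).trans (closure_mono hUint)
  have hz₀D : z₀ ∈ D := ⟨Metric.mem_closedBall_self hr₂0.le, hz₀.ge⟩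
  obtain ⟨M, hM⟩ := hDc.exists_bound_of_continuousOn (hgc.mono hDS)
  have hM0 : 0 ≤ M := (norm_nonneg _).trans (hM z₀ hz₀D)
  set Q := Metric.sphere z₀ r₂ ∩ {w : E2 | 0 ≤ w 0} with hQ
  have hQD : Q ⊆ D := inter_subset_inter_left _ Metric.sphere_subset_closedBall
  have hQc : IsCompact Q := (isCompact_sphere _ _).inter_right isClosed_halfPlane
  have hQne : Q.Nonempty := by
    refine ⟨z₀ + r₂ • EuclideanSpace.single 0 1, ?_, ?_⟩
    · simp [norm_smul, hr₂0.le]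
    · simp [hz₀, hr₂0.le]
  -- `δ` is the least value of `Re q` on the round part of the boundary; the claim will hold where
  -- `Re q < δ`.
  obtain ⟨w₀, hw₀, hmin⟩ := hQc.exists_isMinOn hQne
    (Complex.continuous_re.comp_continuousOn (hqc.mono (hQD.trans hDS)))
  set δ := (q w₀).re with hδ
  have hδ0 : 0 < δ := by
    have hn : ‖w₀ - z₀‖ = r₂ := mem_sphere_iff_norm.mp hw₀.1
    refine hqpos w₀ (hDS1 (hQD hw₀)) ?_ (hn.trans_le hr₂ρ)
    rintro rfl
    simp at hn; linarith
  have hev : ∀ᶠ w in 𝓝[halfBall z₀ R] z₀, (q w).re < δ := by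
    have h2 : ContinuousWithinAt (fun w => (q w).re) (halfBall z₀ R) z₀ :=
      (Complex.continuous_re.comp_continuousOn hqc) z₀ (hDS hz₀D)
    exact h2.eventually_lt continuousWithinAt_const (by simpa [hq] using hδ0)
  obtain ⟨r₃, hr₃, -, hlt⟩ := exists_halfBall_subset_of_eventually hR hev
  refine ⟨min r₃ r₂, lt_min hr₃ hr₂0, (min_le_right _ _).trans (hr₂1.le.trans hr₁R),
    fun z hz => ?_⟩
  have hzD : z ∈ D := ⟨Metric.ball_subset_closedBall (halfBall_mono (min_le_right _ _) hz).1, hz.2⟩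
  have hzlt := hlt z (halfBall_mono (min_le_left _ _) hz)
  have hζU : ∀ z ∈ U, HasFDerivAt ζ (ζ' z) z := fun z hz =>
    (hζ z (interior_subset (hUS hz))).hasFDerivAt (mem_interior_iff_mem_nhds.mp (hUS hz))
  have hqh : ∀ z ∈ U, HolomorphicRel ζ' q z := fun z hz => by
    have h2 : HolomorphicRel ζ' ζ z := ⟨1, by rw [one_smul]; exact hζU z hz⟩
    exact h2.comp (h := fun x => (x - ζ z₀) + (-K : ℂ) * ((x - ζ z₀) * (x - ζ z₀))) (by fun_prop)
  -- Maximum principle for `g exp (-n q)`: it is zero on the flat part and at most `M exp (-n δ)` on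
  -- the round part. Letting `n → ∞` kills `g z`.
  have hbound : ∀ n : ℕ, ‖g z‖ ≤ M * Real.exp (-(δ - (q z).re) * n) := by
    intro n
    have hnorm : ∀ w, ‖g w * Complex.exp (-(n : ℂ) * q w)‖ = ‖g w‖ * Real.exp (-(n * (q w).re)) := by
      intro w
      rw [norm_mul, Complex.norm_exp]
      simp
    have h2 := norm_le_of_forall_boundary_norm_le (g := fun w => g w * Complex.exp (-(n : ℂ) * q w))
      (C := M * Real.exp (-(n * δ))) hUo
      ((convex_ball _ _).inter convex_openHalfPlane).isPreconnected hDc hUD hDU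
      ⟨z₀, hz₀D, fun h => h.2.ne' hz₀⟩ hζU (hc.mono (hUS.trans interior_subset))
      (fun z hz => hinj z (hUS hz)) (by
        have h3 := hgc.mono hDS
        have h4 := hqc.mono hDS
        fun_prop)
      (fun z hz => (hg z (hUS hz)).mul
        ((hqh z hz).comp (h := fun x => Complex.exp (-(n : ℂ) * x)) (by fun_prop)))
      (fun w hw => by
        rw [hnorm]
        by_cases hw0 : w 0 = 0
        · rw [hg0 w (hDS hw.1) hw0]; simp; positivity
        · have hwQ : w ∈ Q := by
            refine ⟨?_, hw.1.2⟩
            by_contra hws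
            exact hw.2 ⟨lt_of_le_of_ne hw.1.1 hws, lt_of_le_of_ne hw.1.2 (Ne.symm hw0)⟩
          have : δ ≤ (q w).re := hmin hwQ
          gcongr
          exact hM w hw.1) hzD
    rw [hnorm] at h2
    have h5 : Real.exp (-(δ - (q z).re) * n) = Real.exp (-(n * δ)) * Real.exp (n * (q z).re) := by
      rw [← Real.exp_add]; ring_nf
    rw [h5, ← mul_assoc]
    calc ‖g z‖ = ‖g z‖ * Real.exp (-(n * (q z).re)) * Real.exp (n * (q z).re) := by
          rw [mul_assoc, ← Real.exp_add]; simp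
      _ ≤ _ := by gcongr
  have hlim : Tendsto (fun n : ℕ => M * Real.exp (-(δ - (q z).re) * n)) atTop (𝓝 (M * 0)) := by
    refine Tendsto.const_mul _ (Real.tendsto_exp_atBot.comp ?_)
    exact tendsto_natCast_atTop_atTop.const_mul_atTop_of_neg (by linarith)
  rw [mul_zero] at hlim
  exact norm_le_zero_iff.mp (ge_of_tendsto' hlim hbound)

/-! ### The conjugate surface. -/

theorem linearIndependent_single :
    LinearIndependent ℝ ![(EuclideanSpace.single 0 1 : E2), EuclideanSpace.single 1 1] := by
  rw [LinearIndependent.pair_iff]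
  intro s t h
  constructor
  · simpa using congrArg (fun v : E2 => v 0) h
  · simpa using congrArg (fun v : E2 => v 1) h

/-- `f` parametrizes an immersed surface with unit normal field `N`, and `g` is a conjugate of
`f`: its differential is that of `f` rotated by a right angle in the tangent plane. -/
structure IsConjugate (S : Set E2) (f g N : E2 → E3) : Prop where
  contDiffOn : ContDiffOn ℝ 2 f S
  injective : ∀ z ∈ S, Function.Injective (fderivWithin ℝ f S z)
  contDiffOn_normal : ContDiffOn ℝ 1 N S
  inner_normal_self : ∀ z ∈ S, inner ℝ (N z) (N z) = (1 : ℝ)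
  inner_normal : ∀ z ∈ S, ∀ v, inner ℝ (N z) (fderivWithin ℝ f S z v) = (0 : ℝ)
  normal_pos : ∀ z ∈ S, 0 < (inner ℝ (N z) (cross (fderivWithin ℝ f S z (EuclideanSpace.single 0 1))
    (fderivWithin ℝ f S z (EuclideanSpace.single 1 1))) : ℝ)
  hasFDerivWithinAt : ∀ z ∈ S,
    HasFDerivWithinAt g ((crossL (N z)).comp (fderivWithin ℝ f S z)) S z

theorem ContDiffOn.fderivWithin_two {S : Set E2} (hS : Convex ℝ S) (hne : (interior S).Nonempty)
    {f : E2 → E3} (hf : ContDiffOn ℝ 2 f S) : ContDiffOn ℝ 1 (fderivWithin ℝ f S) S :=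
  hf.fderivWithin (uniqueDiffOn_convex hS hne) (by norm_num)

/-- Vanishing mean curvature: the differential of the conjugate is closed. -/
theorem cross_fderiv_comm_of_meanCurvature_eq_zero {f N : E2 → E3} {z : E2}
    (hf : ContDiffAt ℝ 2 f z) (hinj : Function.Injective (fderiv ℝ f z))
    (hN : ∀ᶠ w in 𝓝 z, N w = unitNormal f w) (hNd : DifferentiableAt ℝ N z)
    (hN1 : ∀ᶠ w in 𝓝 z, inner ℝ (N w) (N w) = (1 : ℝ))
    (hNf : ∀ᶠ w in 𝓝 z, ∀ v, inner ℝ (N w) (fderiv ℝ f w v) = (0 : ℝ))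
    (hH : meanCurvature f z = 0) (x y : E2) :
    cross (fderiv ℝ N z x) (fderiv ℝ f z y) = cross (fderiv ℝ N z y) (fderiv ℝ f z x) := by
  set a := fderiv ℝ f z (EuclideanSpace.single 0 1) with ha
  set b := fderiv ℝ f z (EuclideanSpace.single 1 1) with hb
  have hab : cross a b ≠ 0 := cross_ne_zero_of_injective hinj linearIndependent_single
  have hf1 : DifferentiableAt ℝ (fderiv ℝ f) z :=
    (hf.fderiv_right (m := 1) (by norm_num)).differentiableAt (by norm_num)
  have hsymm : ∀ u v, fderiv ℝ (fderiv ℝ f) z u v = fderiv ℝ (fderiv ℝ f) z v u :=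
    fun u v => hf.isSymmSndFDerivAt (by simp) u v
  have hpd : ∀ i j, pderiv i (pderiv j f) z =
      fderiv ℝ (fderiv ℝ f) z (EuclideanSpace.single i 1) (EuclideanSpace.single j 1) := by
    intro i j
    have := (hf1.hasFDerivAt.clm_apply
      (hasFDerivAt_const (EuclideanSpace.single j 1 : E2) z)).fderiv
    change fderiv ℝ (fun w => fderiv ℝ f w (EuclideanSpace.single j 1)) z _ = _
    rw [this]; simp
  have hNN : ∀ v, inner ℝ (N z) (fderiv ℝ N z v) = (0 : ℝ) := by
    intro v
    have h1 := hNd.hasFDerivAt.inner ℝ hNd.hasFDerivAt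
    have h2 := h1.unique ((hasFDerivAt_const (1 : ℝ) z).congr_of_eventuallyEq hN1)
    have h3 := congrArg (fun A : E2 →L[ℝ] ℝ => A v) h2
    simp [real_inner_comm] at h3
    linarith
  -- Weingarten's relation, from differentiating `⟨N, df v⟩ = 0`; it turns the second fundamental
  -- form into derivatives of `N`.
  have hNF : ∀ u v, inner ℝ (fderiv ℝ N z u) (fderiv ℝ f z v) =
      (-inner ℝ (fderiv ℝ (fderiv ℝ f) z u v) (N z) : ℝ) := by
    intro u v
    have h1 := hNd.hasFDerivAt.inner ℝ
      (hf1.hasFDerivAt.clm_apply (hasFDerivAt_const v z))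
    have h2 := h1.unique ((hasFDerivAt_const (0 : ℝ) z).congr_of_eventuallyEq
      (hNf.mono fun w hw => hw v))
    have h3 := congrArg (fun A : E2 →L[ℝ] ℝ => A u) h2
    simp only [zero_apply] at h3
    simp at h3
    rw [real_inner_comm (N z)]
    linarith
  have hNz : unitNormal f z = N z := hN.self_of_nhds.symm
  have hcn : 0 < ‖cross a b‖ := norm_pos_iff.mpr hab
  have hNab : cross a b = ‖cross a b‖ • N z := by
    rw [← hNz]
    change _ = ‖cross a b‖ • (‖cross a b‖⁻¹ • cross a b)
    rw [smul_smul, mul_inv_cancel₀ hcn.ne', one_smul]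
  have hden : (inner ℝ a a * inner ℝ b b - inner ℝ a b ^ 2 : ℝ) ≠ 0 := by
    have h1 := inner_cross_cross a b a b
    rw [real_inner_comm a b, ← sq] at h1
    rw [← h1]
    exact inner_self_ne_zero.mpr hab
  have hH' : (inner ℝ a a * inner ℝ (fderiv ℝ N z (EuclideanSpace.single 1 1)) b
      - 2 * (inner ℝ a b * inner ℝ (fderiv ℝ N z (EuclideanSpace.single 0 1)) b)
      + inner ℝ b b * inner ℝ (fderiv ℝ N z (EuclideanSpace.single 0 1)) a : ℝ) = 0 := by
    rw [ha, hb, hNF, hNF, hNF]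
    unfold meanCurvature at hH
    rw [div_eq_zero_iff] at hH
    have h1 := hH.resolve_right (by simpa [firstFund, pderiv, ← ha, ← hb] using hden)
    simp only [secondFund, firstFund, hpd, hNz] at h1
    simp only [pderiv] at h1
    linarith
  have key := cross_eq_cross_of_mean_zero hcn.ne' hNab
    (by intro h; have := hN1.self_of_nhds; rw [h] at this; simp at this)
    (hNN (EuclideanSpace.single 0 1)) (hNN (EuclideanSpace.single 1 1))
    (by rw [hNF, hNF, hsymm]) hH'
  rw [E2_eq_sum x, E2_eq_sum y]
  simp only [map_add, map_smul, ← ha, ← hb, cross_add_left, cross_add_right, cross_smul_left,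
    cross_smul_right, key]
  module

/-- The form `N × df` is of class `C¹` up to the boundary and closed by minimality, so Poincaré's
lemma on the convex set `S` provides `g`. -/
theorem exists_isConjugate {S : Set E2} (hS : Convex ℝ S) (hne : (interior S).Nonempty)
    {f : E2 → E3} (hf : ContDiffOn ℝ 2 f S)
    (hinj : ∀ z ∈ S, Function.Injective (fderivWithin ℝ f S z))
    (hH : ∀ z ∈ interior S, meanCurvature f z = 0) : ∃ g N, IsConjugate S f g N := by
  have hu := uniqueDiffOn_convex hS hne
  have hf1 := hf.fderivWithin_two hS hne
  set n : E2 → E3 := fun z => cross (fderivWithin ℝ f S z (EuclideanSpace.single 0 1))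
    (fderivWithin ℝ f S z (EuclideanSpace.single 1 1)) with hn
  have hn0 : ∀ z ∈ S, n z ≠ 0 := fun z hz =>
    cross_ne_zero_of_injective (hinj z hz) linearIndependent_single
  have hn1 : ContDiffOn ℝ 1 n S := by
    have h0 := hf1.clm_apply (contDiffOn_const (c := (EuclideanSpace.single 0 1 : E2)))
    have h1 := hf1.clm_apply (contDiffOn_const (c := (EuclideanSpace.single 1 1 : E2)))
    exact (crossL.contDiff.comp_contDiffOn h0).clm_apply h1
  set N : E2 → E3 := fun z => ‖n z‖⁻¹ • n z with hNdef
  have hN : ContDiffOn ℝ 1 N S :=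
    ((hn1.norm ℝ hn0).inv fun z hz => norm_ne_zero_iff.mpr (hn0 z hz)).smul hn1
  have hNN : ∀ z ∈ S, inner ℝ (N z) (N z) = (1 : ℝ) := by
    intro z hz
    have := norm_ne_zero_iff.mpr (hn0 z hz)
    simp only [hNdef, inner_smul_left, inner_smul_right, real_inner_self_eq_norm_sq]
    simp; field_simp
  have hNf : ∀ z ∈ S, ∀ v, inner ℝ (N z) (fderivWithin ℝ f S z v) = (0 : ℝ) := by
    intro z hz v
    rw [E2_eq_sum v, map_add, map_smul, map_smul, inner_add_right, inner_smul_right,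
      inner_smul_right, real_inner_comm, real_inner_comm _ (N z)]
    simp [hNdef, hn, inner_smul_right]
  set η : E2 → E2 →L[ℝ] E3 := fun z => (crossL (N z)).comp (fderivWithin ℝ f S z) with hη
  have hη1 : ContDiffOn ℝ 1 η S := (crossL.contDiff.comp_contDiffOn hN).clm_comp hf1
  have hint : ∀ z ∈ interior S, ∀ x y, fderivWithin ℝ η S z x y = fderivWithin ℝ η S z y x := by
    intro z hz x y
    have hzS : S ∈ 𝓝 z := mem_interior_iff_mem_nhds.mp hz
    have hS' : ∀ᶠ w in 𝓝 z, w ∈ interior S := isOpen_interior.mem_nhds hz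
    have heq : ∀ w ∈ interior S, fderivWithin ℝ f S w = fderiv ℝ f w := fun w hw =>
      fderivWithin_of_mem_nhds (mem_interior_iff_mem_nhds.mp hw)
    have hfz : ContDiffAt ℝ 2 f z := hf.contDiffAt hzS
    have hNd : DifferentiableAt ℝ N z := (hN.contDiffAt hzS).differentiableAt (by norm_num)
    have hfd : DifferentiableAt ℝ (fderivWithin ℝ f S) z :=
      (hf1.contDiffAt hzS).differentiableAt (by norm_num)
    have hfeq : fderivWithin ℝ f S =ᶠ[𝓝 z] fderiv ℝ f := hS'.mono heq
    have hff : fderiv ℝ (fderivWithin ℝ f S) z = fderiv ℝ (fderiv ℝ f) z := hfeq.fderiv_eq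
    have hsymm : ∀ u v, fderiv ℝ (fderiv ℝ f) z u v = fderiv ℝ (fderiv ℝ f) z v u :=
      fun u v => hfz.isSymmSndFDerivAt (by simp) u v
    have hder := (((crossL.hasFDerivAt).comp z hNd.hasFDerivAt).clm_comp hfd.hasFDerivAt).fderiv
    have hder' : ∀ u v, fderiv ℝ η z u v = cross (N z) (fderiv ℝ (fderiv ℝ f) z u v)
        + cross (fderiv ℝ N z u) (fderiv ℝ f z v) := by
      intro u v
      have h1 := congrArg (fun A : E2 →L[ℝ] E2 →L[ℝ] E3 => A u v) hder
      rw [hff, heq z hz] at h1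
      simpa using h1
    rw [fderivWithin_of_mem_nhds hzS, hder', hder', hsymm x y]
    -- The part `N × D²f` of the derivative is symmetric; what remains is the identity equivalent to
    -- zero mean curvature.
    congr 1
    refine cross_fderiv_comm_of_meanCurvature_eq_zero hfz ?_ ?_ hNd ?_ ?_ (hH z hz) x y
    · rw [← heq z hz]; exact hinj z (interior_subset hz)
    · exact hS'.mono fun w hw => by simp [hNdef, hn, unitNormal, pderiv, heq w hw]
    · exact hS'.mono fun w hw => hNN w (interior_subset hw)
    · exact hS'.mono fun w hw v => by rw [← heq w hw]; exact hNf w (interior_subset hw) v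
  -- Mean curvature is given only at interior points; closedness reaches the boundary by continuity.
  have hclosed : ∀ z ∈ S, ∀ x y, fderivWithin ℝ η S z x y = fderivWithin ℝ η S z y x := by
    intro z hz x y
    have hcont : ContinuousOn (fderivWithin ℝ η S) S := hη1.continuousOn_fderivWithin hu (by norm_num)
    have h1 : ∀ x y, ContinuousOn (fun z => fderivWithin ℝ η S z x y) S := fun x y =>
      (hcont.clm_apply continuousOn_const).clm_apply continuousOn_const
    exact EqOn.of_subset_closure (fun w hw => hint w hw x y) (h1 x y) (h1 y x) interior_subset
      (by rw [hS.closure_interior_eq_closure_of_nonempty_interior hne]; exact subset_closure) hz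
  obtain ⟨g, hg⟩ := hS.exists_forall_hasFDerivWithinAt_of_fderivWithin_symmetric
    (hη1.differentiableOn (by norm_num)) (fun z hz x _ y _ => hclosed z hz x y)
  refine ⟨g, N, hf, hinj, hN, hNN, hNf, fun z hz => ?_, hg⟩
  have := norm_pos_iff.mpr (hn0 z hz)
  change 0 < inner ℝ (‖n z‖⁻¹ • n z) (n z)
  rw [real_inner_smul_left, real_inner_self_eq_norm_sq]
  positivity

/-! ### The holomorphic curve `f + i g` and analytic continuation in a chart. -/

/-- The component in direction `a` of the holomorphic curve `f + i g`. -/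
noncomputable def holoCoord (f g : E2 → E3) (a : E3) (z : E2) : ℂ :=
  (inner ℝ a (f z) : ℝ) + (inner ℝ a (g z) : ℝ) * Complex.I

/-- The real linear functional `t ↦ ⟨a, t⟩ + i ⟨a, n × t⟩`. -/
noncomputable def tangentFunctional (a n : E3) : E3 →L[ℝ] ℂ :=
  Complex.ofRealCLM ∘L (innerSL ℝ a) + Complex.I • (Complex.ofRealCLM ∘L (innerSL ℝ a) ∘L crossL n)

theorem tangentFunctional_apply (a n t : E3) : tangentFunctional a n t =
    (inner ℝ a t : ℝ) + (inner ℝ a (cross n t) : ℝ) * Complex.I := by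
  simp [tangentFunctional, mul_comm]

/-- The rotation `t ↦ n × t` of the tangent plane becomes multiplication by `-i`. The functional is
thus complex linear on a complex line and determined by its value at one vector `s`. -/
theorem tangentFunctional_frame {n s t : E3} (a : E3) (hn : inner ℝ n n = (1 : ℝ))
    (hs : inner ℝ n s = (0 : ℝ)) (ht : inner ℝ n t = (0 : ℝ)) :
    ((inner ℝ s s : ℝ) : ℂ) * tangentFunctional a n t =
      ((inner ℝ s t : ℝ) - (inner ℝ (cross n s) t : ℝ) * Complex.I) * tangentFunctional a n s := by
  have h := congrArg (tangentFunctional a n) (norm_sq_smul_eq_frame hn hs ht)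
  have h2 : tangentFunctional a n (cross n s) = -Complex.I * tangentFunctional a n s := by
    rw [tangentFunctional_apply, tangentFunctional_apply, cross_cross_eq, hs, hn]
    simp only [zero_smul, one_smul, zero_sub, inner_neg_right]
    push_cast
    linear_combination (inner ℝ a (cross n s) : ℂ) * Complex.I_sq
  rw [map_add, map_smul, map_smul, map_smul, h2] at h
  simp only [Complex.real_smul] at h
  rw [h]; ring

theorem tangentFunctional_self {n s : E3} : tangentFunctional s n s = ((inner ℝ s s : ℝ) : ℂ) := by
  rw [tangentFunctional_apply, inner_right_cross]; simp

theorem tangentFunctional_ne_zero {a n s t : E3} (hn : inner ℝ n n = (1 : ℝ))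
    (hs : inner ℝ n s = (0 : ℝ)) (ht : inner ℝ n t = (0 : ℝ)) (has : tangentFunctional a n s ≠ 0)
    (ht0 : t ≠ 0) : tangentFunctional a n t ≠ 0 := by
  intro h
  have h1 := tangentFunctional_frame a hn hs ht
  rw [h, mul_zero] at h1
  have h2 := (mul_eq_zero.mp h1.symm).resolve_right has
  have h3 := congrArg Complex.re h2
  have h4 := congrArg Complex.im h2
  simp at h3 h4
  have h5 := norm_sq_smul_eq_frame hn hs ht
  rw [h3, h4] at h5
  simp only [zero_smul, add_zero, smul_eq_zero, inner_self_eq_zero] at h5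
  rcases h5 with h5 | h5
  · rw [h5] at has; simp at has
  · exact ht0 h5

section

variable {S : Set E2} {f g N : E2 → E3}

/-- The differential of `holoCoord f g a` if `g` is conjugate to `f`. -/
noncomputable def holoDeriv (S : Set E2) (f N : E2 → E3) (a : E3) (z : E2) : E2 →L[ℝ] ℂ :=
  tangentFunctional a (N z) ∘L fderivWithin ℝ f S z

theorem holoDeriv_apply (a : E3) (z v : E2) :
    holoDeriv S f N a z v = tangentFunctional a (N z) (fderivWithin ℝ f S z v) := rfl

theorem IsConjugate.hasFDerivWithinAt_holoCoord (h : IsConjugate S f g N) (a : E3) {z : E2}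
    (hz : z ∈ S) : HasFDerivWithinAt (holoCoord f g a) (holoDeriv S f N a z) S z := by
  have h1 : HasFDerivWithinAt f (fderivWithin ℝ f S z) S z :=
    (h.contDiffOn.differentiableOn (by norm_num) z hz).hasFDerivWithinAt
  have h2 := h.hasFDerivWithinAt z hz
  have h3 := (Complex.ofRealCLM ∘L (innerSL ℝ a)).hasFDerivAt.comp_hasFDerivWithinAt z h1
  have h4 := (Complex.ofRealCLM ∘L (innerSL ℝ a)).hasFDerivAt.comp_hasFDerivWithinAt z h2
  convert! h3.add (h4.mul_const Complex.I) using 1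

theorem IsConjugate.contDiffOn_holoDeriv (h : IsConjugate S f g N) (hS : Convex ℝ S)
    (hne : (interior S).Nonempty) (a : E3) : ContDiffOn ℝ 1 (holoDeriv S f N a) S := by
  have h1 := h.contDiffOn.fderivWithin_two hS hne
  have h2 : ContDiffOn ℝ 1 (fun z => crossL (N z)) S :=
    crossL.contDiff.comp_contDiffOn h.contDiffOn_normal
  have h3 : ContDiffOn ℝ 1 (fun z => tangentFunctional a (N z)) S := by
    unfold tangentFunctional
    exact contDiffOn_const.add ((contDiffOn_const.clm_comp (contDiffOn_const.clm_comp h2)).const_smul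
      Complex.I)
  exact h3.clm_comp h1

/-- The differentials for `a` and `b` are complex linear on the same complex line, so they are
proportional; the factor is read off at `v`. -/
theorem IsConjugate.holomorphicRel (h : IsConjugate S f g N) (a b : E3) {z : E2}
    (hz : z ∈ interior S) {v : E2} (hv : holoDeriv S f N a z v ≠ 0) :
    HolomorphicRel (holoDeriv S f N a) (holoCoord f g b) z := by
  have hzS := interior_subset hz
  refine ⟨holoDeriv S f N b z v / holoDeriv S f N a z v, ?_⟩
  have h1 := (h.hasFDerivWithinAt_holoCoord b hzS).hasFDerivAt (mem_interior_iff_mem_nhds.mp hz)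
  refine h1.congr_fderiv ?_
  ext w
  have hn := h.inner_normal_self z hzS
  have hs := h.inner_normal z hzS v
  have ht := h.inner_normal z hzS w
  have hA := tangentFunctional_frame a hn hs ht
  have hB := tangentFunctional_frame b hn hs ht
  simp only [← holoDeriv_apply] at hA hB
  have hs0 : ((inner ℝ (fderivWithin ℝ f S z v) (fderivWithin ℝ f S z v) : ℝ) : ℂ) ≠ 0 := by
    rw [Complex.ofReal_ne_zero, inner_self_ne_zero]
    intro h0
    rw [holoDeriv_apply, h0, map_zero] at hv
    exact hv rfl
  simp only [smul_apply, smul_eq_mul]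
  rw [div_mul_eq_mul_div, eq_div_iff hv]
  apply mul_left_cancel₀ hs0
  linear_combination (holoDeriv S f N a z v) * hB - (holoDeriv S f N b z v) * hA

theorem IsConjugate.injective_holoDeriv (h : IsConjugate S f g N) (a : E3) {z : E2}
    (hz : z ∈ S) {v : E2} (hv : holoDeriv S f N a z v ≠ 0) :
    Function.Injective (holoDeriv S f N a z) := by
  rw [injective_iff_map_eq_zero]
  intro w hw
  by_contra hw0
  refine tangentFunctional_ne_zero (h.inner_normal_self z hz) (h.inner_normal z hz v)
    (h.inner_normal z hz w) hv ?_ hw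
  intro h0
  exact hw0 (h.injective z hz (h0.trans (map_zero _).symm))

/-- Near each point the minimal surface has a complex coordinate. -/
theorem IsConjugate.eventually_holoDeriv_ne_zero (h : IsConjugate S f g N) (hS : Convex ℝ S)
    (hne : (interior S).Nonempty) {z : E2} (hz : z ∈ S) {v : E2} (hv : v ≠ 0) :
    ∀ᶠ w in 𝓝[S] z, holoDeriv S f N (fderivWithin ℝ f S z v) w v ≠ 0 := by
  set a := fderivWithin ℝ f S z v with ha
  have h1 : ContinuousWithinAt (fun w => holoDeriv S f N a w v) S z :=
    ((h.contDiffOn_holoDeriv hS hne a).continuousOn.clm_apply continuousOn_const) z hz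
  refine h1.eventually_ne ?_
  change holoDeriv S f N a z v ≠ 0
  rw [holoDeriv_apply, ← ha, tangentFunctional_self, Complex.ofReal_ne_zero, inner_self_ne_zero]
  intro h0
  exact hv (h.injective z hz ((ha ▸ h0).trans (map_zero _).symm))

theorem E3_eq_sum (x : E3) : x = ∑ i, (inner ℝ (EuclideanSpace.single i 1 : E3) x : ℝ) •
    (EuclideanSpace.single i 1 : E3) := by
  ext i; fin_cases i <;> simp [Fin.sum_univ_three, inner_E3]

/-- The given parameters are only `C²`. In the coordinate given by a component of `f + i g`, the
surface is the real part of a holomorphic curve, hence real analytic. -/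
theorem IsConjugate.exists_analytic_coordinate (h : IsConjugate S f g N) (hS : Convex ℝ S)
    {z₀ : E2} (hz₀ : z₀ ∈ interior S) :
    ∃ (ζ : E2 → ℂ) (φ : ℂ → E2), ContinuousAt ζ z₀ ∧ (∀ᶠ y in 𝓝 (ζ z₀), ContinuousAt φ y) ∧
      (∀ᶠ z in 𝓝 z₀, φ (ζ z) = z) ∧ ∀ᶠ y in 𝓝 (ζ z₀), AnalyticAt ℝ (f ∘ φ) y := by
  have hne : (interior S).Nonempty := ⟨z₀, hz₀⟩
  have hS₀ : S ∈ 𝓝 z₀ := mem_interior_iff_mem_nhds.mp hz₀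
  have hi : ∀ᶠ z in 𝓝 z₀, z ∈ interior S := isOpen_interior.mem_nhds hz₀
  set v : E2 := EuclideanSpace.single 1 1 with hv
  set a := fderivWithin ℝ f S z₀ v
  have hev : ∀ᶠ z in 𝓝 z₀, holoDeriv S f N a z v ≠ 0 := by
    have := h.eventually_holoDeriv_ne_zero hS hne (interior_subset hz₀) (v := v) (by simp [hv])
    rwa [nhdsWithin_eq_nhds.mpr hS₀] at this
  have hζ : ∀ᶠ z in 𝓝 z₀, HasFDerivAt (holoCoord f g a) (holoDeriv S f N a z) z :=
    hi.mono fun z hz => (h.hasFDerivWithinAt_holoCoord a (interior_subset hz)).hasFDerivAt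
      (mem_interior_iff_mem_nhds.mp hz)
  obtain ⟨φ, hφc, hφ0, hφ, hd⟩ := exists_local_inverse hζ
    ((h.contDiffOn_holoDeriv hS hne a).continuousOn.continuousAt hS₀)
    (by filter_upwards [hi, hev] with z h1 h2 using h.injective_holoDeriv a (interior_subset h1) h2)
  refine ⟨holoCoord f g a, φ, hζ.self_of_nhds.continuousAt, hφc, hφ, ?_⟩
  have hall : ∀ i : Fin 3, ∀ᶠ y in 𝓝 (holoCoord f g a z₀),
      AnalyticAt ℂ (holoCoord f g (EuclideanSpace.single i 1) ∘ φ) y := by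
    intro i
    have h1 := hd (holoCoord f g (EuclideanSpace.single i 1)) (by
      filter_upwards [hi, hev] with z h1 h2 using h.holomorphicRel a _ h1 h2)
    exact h1.eventually_nhds.mono fun y hy => Complex.analyticAt_iff_eventually_differentiableAt.mpr hy
  filter_upwards [eventually_all.mpr hall] with y hy
  have heq : f ∘ φ = fun y => ∑ i : Fin 3,
      (Complex.reCLM ((holoCoord f g (EuclideanSpace.single i 1) ∘ φ) y)) •
        (EuclideanSpace.single i 1 : E3) := by
    funext y
    conv_lhs => rw [Function.comp_apply, E3_eq_sum (f (φ y))]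
    simp [holoCoord]
  rw [heq]
  refine Finset.analyticAt_fun_sum _ fun i _ => ?_
  exact (((Complex.reCLM.analyticAt _).comp (hy i).restrictScalars)).smul analyticAt_const

/-- Unique continuation along a minimal surface for analytic relations between the coordinates. -/
theorem IsConjugate.eq_zero_of_eventually_eq_zero (h : IsConjugate S f g N) (hS : Convex ℝ S)
    {F : E3 → ℝ} (hF : ∀ x, AnalyticAt ℝ F x) {z₁ : E2} (hz₁ : z₁ ∈ interior S)
    (h₁ : ∀ᶠ z in 𝓝 z₁, F (f z) = 0) {z : E2} (hz : z ∈ S) : F (f z) = 0 := by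
  have hne : (interior S).Nonempty := ⟨z₁, hz₁⟩
  have hsub : interior S ⊆ interior {z | F (f z) = 0} := by
    refine hS.interior.isPreconnected.subset_of_closure_inter_subset isOpen_interior
      ⟨z₁, hz₁, mem_interior_iff_mem_nhds.mpr h₁⟩ ?_
    rintro z₀ ⟨hcl, hz₀⟩
    obtain ⟨ζ, φ, hζ, hφc, hφ, han⟩ := h.exists_analytic_coordinate hS hz₀
    obtain ⟨ε, hε, hball⟩ := Metric.eventually_nhds_iff_ball.mp (hφc.and han)
    have hW : ∀ᶠ z in 𝓝 z₀, (φ (ζ z) = z ∧ ζ z ∈ Metric.ball (ζ z₀) ε) :=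
      hφ.and (hζ (Metric.ball_mem_nhds _ hε))
    obtain ⟨z₂, ⟨h2, h2b⟩, h2i⟩ := mem_closure_iff_nhds.mp hcl _ hW
    have hev : F ∘ (f ∘ φ) =ᶠ[𝓝 (ζ z₂)] 0 := by
      have h3 : Tendsto φ (𝓝 (ζ z₂)) (𝓝 z₂) := by
        simpa [ContinuousAt, h2] using (hball _ h2b).1
      exact h3 (mem_interior_iff_mem_nhds.mp h2i)
    have hzero : EqOn (F ∘ (f ∘ φ)) 0 (Metric.ball (ζ z₀) ε) :=
      AnalyticOnNhd.eqOn_zero_of_preconnected_of_eventuallyEq_zero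
        (fun y hy => (hF _).comp (hball y hy).2) (convex_ball _ _).isPreconnected h2b hev
    refine mem_interior_iff_mem_nhds.mpr (hW.mono fun z hz => ?_)
    have := hzero hz.2
    simpa [hz.1] using this
  have hFc : Continuous F := continuous_iff_continuousAt.mpr fun x => (hF x).continuousAt
  exact EqOn.of_subset_closure (s := interior S) (t := S) (f := fun z => F (f z)) (g := fun _ => 0)
    (fun w hw => interior_subset (s := {z | F (f z) = 0}) (hsub hw))
    (hFc.comp_continuousOn h.contDiffOn.continuousOn) continuousOn_const interior_subset
    (by rw [hS.closure_interior_eq_closure_of_nonempty_interior hne]; exact subset_closure) hz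

end

section

variable {S : Set E2} {f g N : E2 → E3}

/-- Holomorphy with respect to the conformal structure of the minimal surface `f`. -/
def SurfaceHolomorphic (S : Set E2) (f N : E2 → E3) (G : E2 → ℂ) : Prop :=
  ∀ z ∈ interior S, ∀ a v, holoDeriv S f N a z v ≠ 0 → HolomorphicRel (holoDeriv S f N a) G z

theorem SurfaceHolomorphic.comp {G : E2 → ℂ} (hG : SurfaceHolomorphic S f N G) {H : ℂ → ℂ}
    (hH : Differentiable ℂ H) : SurfaceHolomorphic S f N (fun z => H (G z)) :=
  fun z hz a v hv => (hG z hz a v hv).comp (hH _)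

theorem SurfaceHolomorphic.add {G H : E2 → ℂ} (hG : SurfaceHolomorphic S f N G)
    (hH : SurfaceHolomorphic S f N H) : SurfaceHolomorphic S f N (fun z => G z + H z) :=
  fun z hz a v hv => (hG z hz a v hv).add (hH z hz a v hv)

theorem SurfaceHolomorphic.mul {G H : E2 → ℂ} (hG : SurfaceHolomorphic S f N G)
    (hH : SurfaceHolomorphic S f N H) : SurfaceHolomorphic S f N (fun z => G z * H z) :=
  fun z hz a v hv => (hG z hz a v hv).mul (hH z hz a v hv)

theorem IsConjugate.surfaceHolomorphic (h : IsConjugate S f g N) (b : E3) :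
    SurfaceHolomorphic S f N (holoCoord f g b) :=
  fun _ hz a _ hv => h.holomorphicRel a b hz hv

theorem IsConjugate.sub_const (h : IsConjugate S f g N) (c d : E3) :
    IsConjugate S (fun z => f z - c) (fun z => g z - d) N := by
  have hf : fderivWithin ℝ (fun z => f z - c) S = fderivWithin ℝ f S := by
    funext z; exact fderivWithin_sub_const c
  refine ⟨h.contDiffOn.sub contDiffOn_const, ?_, h.contDiffOn_normal, h.inner_normal_self,
    ?_, ?_, ?_⟩
  · rw [hf]; exact h.injective
  · rw [hf]; exact h.inner_normal
  · rw [hf]; exact h.normal_pos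
  · rw [hf]; exact fun z hz => (h.hasFDerivWithinAt z hz).sub_const d

end

/-! ### Boundary uniqueness and differentiation along a boundary arc. -/

section

variable {z₀ : E2} {R : ℝ} {f g N : E2 → E3}

/-- A function that is holomorphic on a minimal surface and vanishes on a boundary arc vanishes
near that arc. -/
theorem IsConjugate.eq_zero_of_eq_zero_on_boundary (h : IsConjugate (halfBall z₀ R) f g N)
    (hz₀ : z₀ 0 = 0) (hR : 0 < R) {G : E2 → ℂ} (hGc : ContinuousOn G (halfBall z₀ R))
    (hG : SurfaceHolomorphic (halfBall z₀ R) f N G)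
    (hG0 : ∀ z ∈ halfBall z₀ R, z 0 = 0 → G z = 0) :
    ∃ r, 0 < r ∧ r ≤ R ∧ ∀ z ∈ halfBall z₀ r, G z = 0 := by
  have hS := convex_halfBall z₀ R
  have hne := nonempty_interior_halfBall hz₀.ge hR
  have hmem := mem_halfBall_self hz₀.ge hR
  set v : E2 := EuclideanSpace.single 1 1 with hv
  set a := fderivWithin ℝ f (halfBall z₀ R) z₀ v with ha
  have ha0 : a ≠ 0 := fun h0 => by
    have : v = 0 := h.injective z₀ hmem ((ha ▸ h0).trans (map_zero _).symm)
    simp [hv] at this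
  obtain ⟨R', hR', hR'R, hev⟩ := exists_halfBall_subset_of_eventually hR
    (h.eventually_holoDeriv_ne_zero hS hne hmem (v := v) (by simp [hv]))
  have hsub := halfBall_mono (z := z₀) hR'R
  have hA := h.contDiffOn_holoDeriv hS hne a
  have hA' : ContDiffOn ℝ 1 (fun z => (-Complex.I) • holoDeriv (halfBall z₀ R) f N a z)
      (halfBall z₀ R) := hA.const_smul _
  have hself : holoDeriv (halfBall z₀ R) f N a z₀ v = ((inner ℝ a a : ℝ) : ℂ) := by
    rw [holoDeriv_apply, ← ha, tangentFunctional_self]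
  have haa : (inner ℝ a a : ℝ) ≠ 0 := inner_self_ne_zero.mpr ha0
  generalize (inner ℝ a a : ℝ) = b at hself haa
  -- The factor `-i` turns the coordinate so that the boundary direction becomes imaginary and the
  -- inward direction gets a positive real part, namely `⟨N, f_u × f_v⟩`.
  obtain ⟨r, hr, hrR', hr0⟩ := _root_.eq_zero_of_eq_zero_on_boundary (R := R') hz₀ hR'
    (ζ := fun z => (-Complex.I) • holoCoord f g a z)
    (ζ' := fun z => (-Complex.I) • holoDeriv (halfBall z₀ R) f N a z)
    (fun z hz => ((h.hasFDerivWithinAt_holoCoord a (hsub hz)).const_smul (-Complex.I)).mono hsub)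
    (((hA'.differentiableOn (by norm_num)) z₀ hmem).mono hsub) (hA'.continuousOn.mono hsub)
    (fun z hz => by
      have hz' := interior_subset hz
      have := h.injective_holoDeriv a (hsub hz') (hev z hz')
      intro x y hxy
      simp only [smul_apply, smul_eq_mul, mul_eq_mul_left_iff] at hxy
      exact this (hxy.resolve_right (by simp)))
    (by
      simp only [smul_apply, holoDeriv_apply, tangentFunctional_apply]
      simp
      have := h.normal_pos z₀ hmem
      rwa [inner_cross_cyclic, inner_cross_cyclic] at this)
    (by simp only [smul_apply, ← hv, hself]; simp)
    (by simp only [smul_apply, ← hv, hself]; simpa using haa)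
    (hGc.mono hsub)
    (fun z hz => by
      obtain ⟨c, hc⟩ := hG z (interior_mono hsub hz) a v (hev z (interior_subset hz))
      refine ⟨c * Complex.I, hc.congr_fderiv ?_⟩
      ext w
      simp only [smul_apply, smul_eq_mul]
      linear_combination ((c * holoDeriv (halfBall z₀ R) f N a z w)) * Complex.I_sq)
    (fun z hz hz0 => hG0 z (hsub hz) hz0)
  exact ⟨r, hr, hrR'.trans hR'R, hr0⟩

theorem add_smul_single_eventually_mem {z : E2} (hz : z ∈ halfBall z₀ R) (hz0 : z 0 = 0) :
    ∀ᶠ t : ℝ in 𝓝 0, z + t • EuclideanSpace.single 1 1 ∈ halfBall z₀ R ∩ {w | w 0 = 0} := by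
  have hc : ContinuousAt (fun t : ℝ => z + t • (EuclideanSpace.single 1 1 : E2)) 0 := by fun_prop
  have := hc.eventually (Metric.isOpen_ball.mem_nhds (by simpa using hz.1))
  filter_upwards [this] with t ht
  have h0 : (z + t • (EuclideanSpace.single 1 1 : E2)) 0 = 0 := by simp [hz0]
  exact ⟨⟨ht, h0.ge⟩, h0⟩

/-- The boundary line stays in the half disc in both directions, so the one-sided differential still
has an ordinary derivative along it. -/
theorem apply_single_eq_zero_of_const_on_boundary {V : Type*} [NormedAddCommGroup V]
    [NormedSpace ℝ V] {ψ : E2 → V} {A : E2 →L[ℝ] V} {c : V} {z : E2}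
    (hz : z ∈ halfBall z₀ R) (hz0 : z 0 = 0) (hψ : HasFDerivWithinAt ψ A (halfBall z₀ R) z)
    (hc : ∀ w ∈ halfBall z₀ R, w 0 = 0 → ψ w = c) : A (EuclideanSpace.single 1 1) = 0 := by
  have hev := add_smul_single_eventually_mem hz hz0
  have hp : HasDerivAt (fun t : ℝ => z + t • (EuclideanSpace.single 1 1 : E2))
      (EuclideanSpace.single 1 1) 0 := by
    simpa using ((hasDerivAt_id (0 : ℝ)).smul_const (EuclideanSpace.single 1 1 : E2)).const_add z
  have h1 := HasFDerivWithinAt.comp_hasDerivAt_of_eq (0 : ℝ) hψ hp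
    (hev.mono fun t ht => ht.1) (by simp)
  exact h1.unique ((hasDerivAt_const (0 : ℝ) c).congr_of_eventuallyEq
    (hev.mono fun t ht => hc _ ht.1 ht.2))

theorem eq_on_boundary_of_apply_single_eq_zero {V : Type*} [NormedAddCommGroup V]
    [NormedSpace ℝ V] {ψ : E2 → V} {A : E2 → E2 →L[ℝ] V} (hz₀ : z₀ 0 = 0)
    (hψ : ∀ z ∈ halfBall z₀ R, HasFDerivWithinAt ψ (A z) (halfBall z₀ R) z)
    (hA : ∀ z ∈ halfBall z₀ R, z 0 = 0 → A z (EuclideanSpace.single 1 1) = 0)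
    {z : E2} (hz : z ∈ halfBall z₀ R) (hz0 : z 0 = 0) : ψ z = ψ z₀ := by
  have hR : 0 < R := Metric.pos_of_mem_ball hz.1
  have hmem := mem_halfBall_self hz₀.ge hR
  have hseg : ∀ t ∈ Icc (0 : ℝ) 1, AffineMap.lineMap z₀ z t ∈ halfBall z₀ R :=
    fun t ht => (convex_halfBall z₀ R).lineMap_mem hmem hz ht
  have hd : z - z₀ = (z 1 - z₀ 1) • EuclideanSpace.single 1 1 := by
    conv_lhs => rw [E2_eq_sum (z - z₀)]
    simp [hz0, hz₀]
  have h1 : ∀ t ∈ Icc (0 : ℝ) 1, HasDerivWithinAt (fun t => ψ (AffineMap.lineMap z₀ z t)) 0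
      (Icc 0 1) t := by
    intro t ht
    have h2 := (hψ _ (hseg t ht)).comp_hasDerivWithinAt t
      (AffineMap.hasDerivWithinAt_lineMap (a := z₀) (b := z)) hseg
    rw [hd, map_smul, hA _ (hseg t ht), smul_zero] at h2
    · exact h2
    · simp [AffineMap.lineMap_apply, hz0, hz₀]
  have h2 := (convex_Icc (0 : ℝ) 1).norm_image_sub_le_of_norm_hasDerivWithin_le
    (C := 0) h1 (by simp) (left_mem_Icc.mpr zero_le_one) (right_mem_Icc.mpr zero_le_one)
  simpa [sub_eq_zero] using h2

end

/-! ### Surfaces bounded by a circular arc with constant angle. -/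

/-- This removes sign ambiguities along the arc: the angle condition and the unit length of the
normal determine only squares. -/
theorem IsPreconnected.eq_of_sq_eq_const {α : Type*} [TopologicalSpace α] {s : Set α}
    (hs : IsPreconnected s) {φ : α → ℝ} (hφ : ContinuousOn φ s) {c : ℝ}
    (hc : ∀ x ∈ s, φ x ^ 2 = c) {x y : α} (hx : x ∈ s) (hy : y ∈ s) : φ x = φ y := by
  by_cases h0 : φ y = 0
  · have := hc x hx
    rw [← hc y hy, h0] at this
    rw [h0]
    simpa using this
  · rcases hs.eq_or_eq_neg_of_sq_eq hφ (continuousOn_const (c := φ y))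
      (fun w hw => by
        change φ w ^ 2 = φ y ^ 2
        rw [hc w hw, hc y hy]) (fun _ => h0) with h1 | h1
    · exact h1 hx
    · have h2 : φ y = -φ y := h1 hy
      exact absurd (by linarith) h0

theorem convex_halfBall_boundary (z : E2) (r : ℝ) :
    Convex ℝ (halfBall z r ∩ {w : E2 | w 0 = 0}) :=
  (convex_halfBall z r).inter
    (convex_hyperplane (f := fun w : E2 => w 0) ⟨fun _ _ => rfl, fun _ _ => rfl⟩ 0)

/-- Position of the unit normal along a circle with axis direction `m` centred at the origin. -/
theorem circle_frame {m y t n : E3} {r : ℝ} (hm : inner ℝ m m = (1 : ℝ)) (hr : 0 < r)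
    (hmy : inner ℝ m y = (0 : ℝ)) (hy : inner ℝ y y = (r ^ 2 : ℝ)) (ht0 : t ≠ 0)
    (hmt : inner ℝ m t = (0 : ℝ)) (hyt : inner ℝ y t = (0 : ℝ)) (hn : inner ℝ n n = (1 : ℝ))
    (hnt : inner ℝ n t = (0 : ℝ)) :
    (inner ℝ n y) ^ 2 = (r ^ 2 * (1 - inner ℝ n m ^ 2) : ℝ) ∧ ∃ σ : ℝ, t = σ • cross m y ∧
      cross n t = σ • ((inner ℝ n y : ℝ) • m - (inner ℝ n m : ℝ) • y) := by
  have hr2 : (r ^ 2 : ℝ) ≠ 0 := by positivity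
  have hcc : inner ℝ (cross m y) (cross m y) = (r ^ 2 : ℝ) := by
    rw [inner_cross_cross, hm, hy, hmy]; ring
  have h1 := norm_sq_smul_eq_of_orthogonal hmt hyt
  rw [hcc] at h1
  have h2 : t = ((r ^ 2)⁻¹ * inner ℝ (cross m y) t : ℝ) • cross m y := by
    rw [mul_smul, ← h1, smul_smul, inv_mul_cancel₀ hr2, one_smul]
  set σ : ℝ := (r ^ 2)⁻¹ * inner ℝ (cross m y) t
  have hσ : σ ≠ 0 := fun h => ht0 (by rw [h2, h, zero_smul])
  refine ⟨?_, σ, h2, ?_⟩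
  -- As `t` is parallel to `m × y`, the unit normal lies in the span of `m` and `y`; the claim is
  -- Pythagoras there.
  · have hncm : inner ℝ n (cross m y) = (0 : ℝ) := by
      rw [h2, inner_smul_right] at hnt
      exact (mul_eq_zero.mp hnt).resolve_left hσ
    have h3 := norm_sq_smul_eq_frame (n := m) (s := y) (t := n - (inner ℝ n m : ℝ) • m) hm hmy
      (by rw [inner_sub_right, inner_smul_right, hm, real_inner_comm]; ring)
    have h4 := congrArg (fun x : E3 => (inner ℝ n x : ℝ)) h3
    simp only [inner_smul_right, inner_sub_right, inner_add_right, hncm, hn, hy,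
      real_inner_comm n y, real_inner_comm m y, hmy] at h4
    linear_combination -h4
  · conv_lhs => rw [h2]
    rw [cross_smul_right, cross_cross_eq]

/-- From the exponential representation of the holomorphic coordinates to the distance from the
axis. -/
theorem sq_add_sq_eq_of_exp {a b w : ℂ} {p q μ : ℝ}
    (h₁ : (a + Complex.I * b) = p * Complex.exp (w / μ))
    (h₂ : (a - Complex.I * b) = q * Complex.exp (-(w / μ))) :
    a.re ^ 2 + b.re ^ 2 = ((p * Real.exp (w.re / μ) + q * Real.exp (-(w.re / μ))) / 2) ^ 2 := by
  have hre : (w / μ).re = w.re / μ := by simp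
  set θ := (w / μ).im with hθ
  have e1 := congrArg Complex.re h₁
  have e2 := congrArg Complex.im h₁
  have e3 := congrArg Complex.re h₂
  have e4 := congrArg Complex.im h₂
  simp only [Complex.add_re, Complex.sub_re, Complex.add_im, Complex.sub_im, Complex.mul_re,
    Complex.mul_im, Complex.I_re, Complex.I_im, Complex.ofReal_re, Complex.ofReal_im,
    Complex.exp_re, Complex.exp_im, Complex.neg_re, Complex.neg_im, hre, ← hθ, Real.cos_neg,
    Real.sin_neg] at e1 e2 e3 e4
  have ha : a.re = (p * Real.exp (w.re / μ) + q * Real.exp (-(w.re / μ))) / 2 * Real.cos θ := by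
    linarith
  have hb : b.re = (p * Real.exp (w.re / μ) + q * Real.exp (-(w.re / μ))) / 2 * Real.sin θ := by
    linarith
  rw [ha, hb]
  linear_combination (((p * Real.exp (w.re / μ) + q * Real.exp (-(w.re / μ))) / 2) ^ 2) *
    Real.sin_sq_add_cos_sq θ

/-- The numbers `p / |μ|` and `q / |μ|` are inverse to each other, so a shift of `t` absorbs them.
The sign of `μ` does not matter because `cosh` is even. -/
theorem exists_cosh_eq {p q μ : ℝ} (hp : 0 < p) (hq : 0 < q) (hμ : p * q = μ ^ 2) :
    ∃ s : ℝ, ∀ t : ℝ, (p * Real.exp (t / μ) + q * Real.exp (-(t / μ))) / 2 =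
      |μ| * Real.cosh ((t - s) / |μ|) := by
  have hμ0 : μ ≠ 0 := by rintro rfl; have := mul_pos hp hq; simp [hμ] at this
  have hc : 0 < |μ| := abs_pos.mpr hμ0
  have hpq : p / |μ| * (q / |μ|) = 1 := by
    rw [div_mul_div_comm, hμ, ← sq, sq_abs, div_self (pow_ne_zero 2 hμ0)]
  refine ⟨Real.log (q / |μ|) * μ, fun t => ?_⟩
  have h1 : Real.cosh ((t - Real.log (q / |μ|) * μ) / |μ|) =
      Real.cosh (t / μ - Real.log (q / |μ|)) := by
    rcases abs_choice μ with h | h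
    · rw [h]; congr 1; field_simp
    · rw [h, ← Real.cosh_neg]; congr 1; field_simp
  have hq' : Real.exp (Real.log (q / |μ|)) = q / |μ| := Real.exp_log (by positivity)
  have hp' : Real.exp (-Real.log (q / |μ|)) = p / |μ| := by
    rw [Real.exp_neg, hq']; exact inv_eq_of_mul_eq_one_left hpq
  rw [h1, Real.cosh_eq, neg_sub, sub_eq_add_neg, Real.exp_add, hp', sub_eq_add_neg (Real.log _),
    Real.exp_add, hq']
  field_simp

theorem norm_sub_axis_sq {m e x : E3} (hm : inner ℝ m m = (1 : ℝ)) (he : inner ℝ e e = (1 : ℝ))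
    (hme : inner ℝ m e = (0 : ℝ)) :
    ‖x - (inner ℝ x m : ℝ) • m‖ ^ 2 = (inner ℝ e x ^ 2 + inner ℝ (cross m e) x ^ 2 : ℝ) := by
  have h := norm_sq_smul_eq_frame (n := m) (s := e) (t := x - (inner ℝ x m : ℝ) • m) hm hme
    (by rw [inner_sub_right, inner_smul_right, hm, real_inner_comm]; ring)
  rw [he, one_smul] at h
  have hmc : inner ℝ (cross m e) m = (0 : ℝ) := by rw [real_inner_comm, inner_left_cross]
  have hec : inner ℝ (cross m e) e = (0 : ℝ) := by rw [real_inner_comm, inner_right_cross]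
  simp only [inner_sub_right, inner_smul_right, real_inner_comm m e, hme, hmc, mul_zero,
    sub_zero] at h
  have hcc : inner ℝ (cross m e) (cross m e) = (1 : ℝ) := by
    rw [inner_cross_cross, hm, he, hme]; ring
  rw [← real_inner_self_eq_norm_sq, h]
  simp only [inner_add_left, inner_add_right, inner_smul_left, inner_smul_right, he, hec, hcc,
    inner_right_cross]
  simp; ring

theorem mem_catenoid_iff {a m x : E3} {c : ℝ} (hc : 0 < c) : x ∈ catenoid a m c ↔
    ‖(x - a) - (inner ℝ (x - a) m : ℝ) • m‖ ^ 2 -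
      (c * Real.cosh ((inner ℝ (x - a) m : ℝ) / c)) ^ 2 = 0 := by
  have h : 0 < Real.cosh ((inner ℝ (x - a) m : ℝ) / c) := Real.cosh_pos _
  rw [sub_eq_zero, sq_eq_sq₀ (norm_nonneg _) (by positivity)]
  rfl

section

variable {z₀ : E2} {R : ℝ} {f g N : E2 → E3}

/-- A minimal surface that meets a plane along a circular arc at a constant angle is planar or
catenoidal near the arc: normalized version, with the circle centred at the origin. -/
theorem IsConjugate.planar_or_catenoid_of_centered (h : IsConjugate (halfBall z₀ R) f g N)
    (hz₀ : z₀ 0 = 0) (hR : 0 < R) {m : E3} (hm : inner ℝ m m = (1 : ℝ)) {r κ : ℝ} (hr : 0 < r)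
    (hfm : ∀ z ∈ halfBall z₀ R, z 0 = 0 → inner ℝ m (f z) = (0 : ℝ))
    (hfr : ∀ z ∈ halfBall z₀ R, z 0 = 0 → inner ℝ (f z) (f z) = (r ^ 2 : ℝ))
    (hκ : ∀ z ∈ halfBall z₀ R, z 0 = 0 → inner ℝ (N z) m = κ)
    (hg : g z₀ = κ • cross m (f z₀)) :
    ∃ ρ, 0 < ρ ∧ ρ ≤ R ∧ ((∀ z ∈ halfBall z₀ ρ, inner ℝ m (f z) = (0 : ℝ)) ∨
      ∃ (s c : ℝ), 0 < c ∧ ∀ z ∈ halfBall z₀ ρ, f z ∈ catenoid (s • m) m c) := by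
  set S := halfBall z₀ R with hS
  have hmem : z₀ ∈ S := mem_halfBall_self hz₀.ge hR
  set v : E2 := EuclideanSpace.single 1 1 with hv
  have hf' : ∀ z ∈ S, HasFDerivWithinAt f (fderivWithin ℝ f S z) S z := fun z hz =>
    (h.contDiffOn.differentiableOn (by norm_num) z hz).hasFDerivWithinAt
  have hfc : ContinuousOn f S := h.contDiffOn.continuousOn
  have hZc : ∀ a, ContinuousOn (holoCoord f g a) S := fun a z hz =>
    (h.hasFDerivWithinAt_holoCoord a hz).continuousWithinAt
  -- the tangent vectors along the arc
  have hframe : ∀ z ∈ S, z 0 = 0 → (inner ℝ (N z) (f z)) ^ 2 = (r ^ 2 * (1 - κ ^ 2) : ℝ) ∧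
      ∃ σ : ℝ, fderivWithin ℝ f S z v = σ • cross m (f z) ∧
        cross (N z) (fderivWithin ℝ f S z v) = σ • ((inner ℝ (N z) (f z) : ℝ) • m - κ • f z) := by
    intro z hz hz0
    have h1 := apply_single_eq_zero_of_const_on_boundary hz hz0
      ((innerSL ℝ m).hasFDerivAt.comp_hasFDerivWithinAt z (hf' z hz)) (c := 0)
      (fun w hw hw0 => by simpa using hfm w hw hw0)
    have h2 := apply_single_eq_zero_of_const_on_boundary hz hz0
      ((hf' z hz).inner ℝ (hf' z hz)) (c := r ^ 2) (fun w hw hw0 => hfr w hw hw0)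
    have h1' : inner ℝ m (fderivWithin ℝ f S z v) = (0 : ℝ) := by simpa using h1
    have h2' : inner ℝ (f z) (fderivWithin ℝ f S z v) = (0 : ℝ) := by
      simp [real_inner_comm (f z)] at h2
      exact h2
    have hne : fderivWithin ℝ f S z v ≠ 0 := fun h0 => by
      have : v = 0 := h.injective z hz (h0.trans (map_zero _).symm)
      simp [hv] at this
    have := circle_frame hm hr (hfm z hz hz0) (hfr z hz hz0) hne h1' h2'
      (h.inner_normal_self z hz) (h.inner_normal z hz v)
    rwa [hκ z hz hz0] at this
  -- the normal makes a constant angle with the radial direction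
  set μ : ℝ := inner ℝ (N z₀) (f z₀) with hμ
  have hμ2 : μ ^ 2 = r ^ 2 * (1 - κ ^ 2) := (hframe z₀ hmem hz₀).1
  have hμc : ∀ z ∈ S, z 0 = 0 → inner ℝ (N z) (f z) = μ := fun z hz hz0 =>
    (convex_halfBall_boundary z₀ R).isPreconnected.eq_of_sq_eq_const
      ((h.contDiffOn_normal.continuousOn.inner hfc).mono inter_subset_left)
      (fun w hw => (hframe w hw.1 hw.2).1) ⟨hz, hz0⟩ ⟨hmem, hz₀⟩
  have hder : ∀ z ∈ S, z 0 = 0 → ∃ σ : ℝ, fderivWithin ℝ f S z v = σ • cross m (f z) ∧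
      cross (N z) (fderivWithin ℝ f S z v) = σ • (μ • m - κ • f z) := by
    intro z hz hz0
    have := (hframe z hz hz0).2
    rwa [hμc z hz hz0] at this
  have hmc : ∀ y, inner ℝ m (cross m y) = (0 : ℝ) := fun y => inner_left_cross m y
  by_cases hμ0 : μ = 0
  · -- the planar case
    have hconst : ∀ z ∈ S, z 0 = 0 → holoCoord f g m z = holoCoord f g m z₀ := fun z hz hz0 =>
      eq_on_boundary_of_apply_single_eq_zero hz₀
        (fun z hz => h.hasFDerivWithinAt_holoCoord m hz) (fun w hw hw0 => by
          obtain ⟨σ, h1, h2⟩ := hder w hw hw0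
          rw [holoDeriv_apply, tangentFunctional_apply, ← hv, h2, h1, hμ0]
          simp [inner_smul_right, hmc, hfm w hw hw0]) hz hz0
    obtain ⟨ρ, hρ, hρR, hz⟩ := h.eq_zero_of_eq_zero_on_boundary hz₀ hR
      (G := fun z => holoCoord f g m z + -holoCoord f g m z₀)
      ((hZc m).add continuousOn_const)
      ((h.surfaceHolomorphic m).comp (H := fun x => x + -holoCoord f g m z₀) (by fun_prop))
      (fun z hz hz0 => by rw [hconst z hz hz0]; ring)
    refine ⟨ρ, hρ, hρR, Or.inl fun z hz' => ?_⟩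
    have h1 := congrArg Complex.re (hz z hz')
    simp [holoCoord, hfm z₀ hmem hz₀] at h1
    exact h1
  -- the catenoidal case
  have hκ1 : 0 < 1 - κ ^ 2 := by
    have : 0 < r ^ 2 * (1 - κ ^ 2) := by rw [← hμ2]; positivity
    exact (mul_pos_iff_of_pos_left (by positivity)).mp this
  have hκlt := (sq_lt_one_iff_abs_lt_one κ).mp (by linarith)
  have hp : 0 < (1 - κ) * r := mul_pos (by linarith [(abs_lt.mp hκlt).2]) hr
  have hq : 0 < (1 + κ) * r := mul_pos (by linarith [(abs_lt.mp hκlt).1]) hr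
  set e : E3 := r⁻¹ • f z₀ with he
  set e' : E3 := cross m e with he'
  have hee : inner ℝ e e = (1 : ℝ) := by
    rw [he, inner_smul_left, inner_smul_right, hfr z₀ hmem hz₀]
    simp; field_simp
  have hme : inner ℝ m e = (0 : ℝ) := by rw [he, inner_smul_right, hfm z₀ hmem hz₀, mul_zero]
  have hem : inner ℝ e m = (0 : ℝ) := by rw [real_inner_comm]; exact hme
  have he'm : inner ℝ e' m = (0 : ℝ) := by rw [real_inner_comm]; exact hmc e
  have hec : ∀ y, inner ℝ e (cross m y) = (-inner ℝ e' y : ℝ) := fun y => by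
    rw [inner_cross_cyclic, inner_cross_cyclic, inner_cross_swap, real_inner_comm]
  have he'c : ∀ y, inner ℝ m y = (0 : ℝ) → inner ℝ e' (cross m y) = (inner ℝ e y : ℝ) := by
    intro y hy
    rw [he', inner_cross_cross, hm, hy]; ring
  have hef0 : inner ℝ e (f z₀) = r := by
    rw [he, real_inner_smul_left, hfr z₀ hmem hz₀]; field_simp
  have he'f0 : inner ℝ e' (f z₀) = (0 : ℝ) := by
    have : f z₀ = r • e := by rw [he, smul_smul, mul_inv_cancel₀ hr.ne', one_smul]
    rw [this, inner_smul_right, he', real_inner_comm, inner_right_cross, mul_zero]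
  -- the conjugate surface along the arc
  have hgarc : ∀ a, inner ℝ a m = (0 : ℝ) → ∀ z ∈ S, z 0 = 0 →
      inner ℝ a (g z) = (κ * inner ℝ a (cross m (f z)) : ℝ) := by
    -- Along the arc the derivative of `g - κ m × f` is `σ μ m`, because `m × (m × f) = -f`. Its
    -- horizontal components are therefore constant, and they are zero at `z₀`.
    intro a ha z hz hz0
    have h1 := eq_on_boundary_of_apply_single_eq_zero hz₀
      (ψ := fun z => (innerSL ℝ a) (g z - κ • crossL m (f z)))
      (A := fun z => (innerSL ℝ a) ∘L ((crossL (N z)).comp (fderivWithin ℝ f S z) -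
        κ • (crossL m).comp (fderivWithin ℝ f S z)))
      (fun z hz => (innerSL ℝ a).hasFDerivAt.comp_hasFDerivWithinAt z
        ((h.hasFDerivWithinAt z hz).sub
          (((crossL m).hasFDerivAt.comp_hasFDerivWithinAt z (hf' z hz)).const_smul κ)))
      (fun w hw hw0 => by
        obtain ⟨σ, h1, h2⟩ := hder w hw hw0
        simp only [ContinuousLinearMap.comp_apply, sub_apply, smul_apply, crossL_apply, ← hv, h2]
        rw [h1, cross_smul_right, cross_cross_eq, hm, hfm w hw hw0]
        simp only [innerSL_apply_apply, inner_sub_right, inner_smul_right, ha]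
        ring) hz hz0
    simp only [crossL_apply, hg, sub_self, map_zero] at h1
    simp [inner_sub_right, inner_smul_right] at h1
    linarith
  set Z := holoCoord f g m with hZ
  set P : E2 → ℂ := fun z => holoCoord f g e z + Complex.I * holoCoord f g e' z with hP
  set Q : E2 → ℂ := fun z => holoCoord f g e z + -Complex.I * holoCoord f g e' z with hQ
  have hParc : ∀ z ∈ S, z 0 = 0 →
      P z = (1 - κ) * ((inner ℝ e (f z) : ℝ) + Complex.I * (inner ℝ e' (f z) : ℝ)) := by
    intro z hz hz0
    simp only [hP, holoCoord, hgarc e hem z hz hz0, hgarc e' he'm z hz hz0, hec,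
      he'c _ (hfm z hz hz0)]
    push_cast
    linear_combination ((κ : ℂ) * (inner ℝ e (f z) : ℝ)) * Complex.I_sq
  have hQarc : ∀ z ∈ S, z 0 = 0 →
      Q z = (1 + κ) * ((inner ℝ e (f z) : ℝ) - Complex.I * (inner ℝ e' (f z) : ℝ)) := by
    intro z hz hz0
    simp only [hQ, holoCoord, hgarc e hem z hz hz0, hgarc e' he'm z hz hz0, hec,
      he'c _ (hfm z hz hz0)]
    push_cast
    linear_combination (-(κ : ℂ) * (inner ℝ e (f z) : ℝ)) * Complex.I_sq
  have hZ0 : Z z₀ = 0 := by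
    simp [hZ, holoCoord, hg, hfm z₀ hmem hz₀, inner_smul_right]
  have hP0 : P z₀ = (((1 - κ) * r : ℝ) : ℂ) := by
    rw [hParc z₀ hmem hz₀, hef0, he'f0]; simp
  have hQ0 : Q z₀ = (((1 + κ) * r : ℝ) : ℂ) := by
    rw [hQarc z₀ hmem hz₀, hef0, he'f0]; simp
  have hμ0' : (μ : ℂ) ≠ 0 := Complex.ofReal_ne_zero.mpr hμ0
  -- derivatives along the arc
  have hZd : ∀ a z, z ∈ S → HasFDerivWithinAt (holoCoord f g a) (holoDeriv S f N a z) S z :=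
    fun a z hz => h.hasFDerivWithinAt_holoCoord a hz
  have harc : ∀ z ∈ S, z 0 = 0 → ∃ σ : ℝ, holoDeriv S f N m z v = Complex.I * σ * μ ∧
      holoDeriv S f N e z v + Complex.I * holoDeriv S f N e' z v = Complex.I * σ * P z ∧
      holoDeriv S f N e z v + -Complex.I * holoDeriv S f N e' z v = -Complex.I * σ * Q z := by
    intro z hz hz0
    obtain ⟨σ, h1, h2⟩ := hder z hz hz0
    rw [h1] at h2
    refine ⟨σ, ?_, ?_, ?_⟩
    · simp only [holoDeriv_apply, tangentFunctional_apply, h1, h2, inner_smul_right,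
        inner_sub_right, hfm z hz hz0, hm, hmc]
      push_cast; ring
    · rw [hParc z hz hz0]
      simp only [holoDeriv_apply, tangentFunctional_apply, h1, h2, inner_smul_right,
        inner_sub_right, hec, he'c _ (hfm z hz hz0), hem, he'm]
      push_cast
      linear_combination (-(σ : ℂ) * (inner ℝ e' (f z) : ℝ)) * Complex.I_sq
    · rw [hQarc z hz hz0]
      simp only [holoDeriv_apply, tangentFunctional_apply, h1, h2, inner_smul_right,
        inner_sub_right, hec, he'c _ (hfm z hz hz0), hem, he'm]
      push_cast
      linear_combination (-(σ : ℂ) * (inner ℝ e' (f z) : ℝ)) * Complex.I_sq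
  -- Common argument for `P` (`ε = -1`, `c = i`) and `Q` (`ε = 1`, `c = -i`): the function `W exp (ε
  -- Z / μ)` has zero derivative along the arc, so it is constant there and hence nearby.
  have hexp : ∀ (ε : ℂ) (W : E2 → ℂ) (c : ℂ), (∀ z ∈ S, HasFDerivWithinAt W
      (holoDeriv S f N e z + c • holoDeriv S f N e' z) S z) →
      (∀ z ∈ S, z 0 = 0 → ∃ σ : ℝ, holoDeriv S f N m z v = Complex.I * σ * μ ∧
        holoDeriv S f N e z v + c * holoDeriv S f N e' z v = -(ε * Complex.I * σ) * W z) →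
      SurfaceHolomorphic S f N W →
      ∃ ρ, 0 < ρ ∧ ρ ≤ R ∧ ∀ z ∈ halfBall z₀ ρ, W z = W z₀ * Complex.exp (-(ε * (Z z / μ))) := by
    intro ε W c hW hσ hhol
    have hWc : ContinuousOn W S := fun z hz => (hW z hz).continuousWithinAt
    have hZcm : ContinuousOn Z S := hZc m
    have hconst : ∀ z ∈ S, z 0 = 0 → W z * Complex.exp (ε * (Z z / μ)) = W z₀ := by
      intro z hz hz0
      have h1 := eq_on_boundary_of_apply_single_eq_zero hz₀
        (fun z hz => (hW z hz).mul
          (((hZd m z hz).mul_const ((μ : ℂ)⁻¹)).const_mul ε).cexp) (fun w hw hw0 => by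
            obtain ⟨σ, h2, h3⟩ := hσ w hw hw0
            simp only [add_apply, smul_apply, smul_eq_mul, ← hv]
            simp only [h2, h3]
            field_simp
            ring) hz hz0
      simpa [← hZ, hZ0, div_eq_mul_inv] using h1
    obtain ⟨ρ, hρ, hρR, h0⟩ := h.eq_zero_of_eq_zero_on_boundary hz₀ hR
      (G := fun z => W z * Complex.exp (ε * (Z z / μ)) + -W z₀) (by fun_prop)
      ((hhol.mul ((h.surfaceHolomorphic m).comp
        (H := fun x => Complex.exp (ε * (x / μ))) (by fun_prop))).comp
          (H := fun x => x + -W z₀) (by fun_prop))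
      (fun z hz hz0 => by rw [hconst z hz hz0]; ring)
    refine ⟨ρ, hρ, hρR, fun z hz => ?_⟩
    have h1 : W z * Complex.exp (ε * (Z z / μ)) = W z₀ := by
      have := h0 z hz
      linear_combination this
    rw [← h1, mul_assoc, ← Complex.exp_add, add_neg_cancel, Complex.exp_zero, mul_one]
  obtain ⟨ρ₁, hρ₁, hρ₁R, hP1⟩ := hexp (-1) P Complex.I
    (fun z hz => (hZd e z hz).add ((hZd e' z hz).const_mul Complex.I))
    (fun z hz hz0 => by
      obtain ⟨σ, h1, h2, h3⟩ := harc z hz hz0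
      exact ⟨σ, h1, by rw [h2]; ring⟩)
    ((h.surfaceHolomorphic e).add ((h.surfaceHolomorphic e').comp
      (H := fun x => Complex.I * x) (by fun_prop)))
  obtain ⟨ρ₂, hρ₂, hρ₂R, hQ1⟩ := hexp 1 Q (-Complex.I)
    (fun z hz => (hZd e z hz).add ((hZd e' z hz).const_mul (-Complex.I)))
    (fun z hz hz0 => by
      obtain ⟨σ, h1, h2, h3⟩ := harc z hz hz0
      exact ⟨σ, h1, by rw [h3]; ring⟩)
    ((h.surfaceHolomorphic e).add ((h.surfaceHolomorphic e').comp
      (H := fun x => -Complex.I * x) (by fun_prop)))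
  obtain ⟨s, hs⟩ := exists_cosh_eq hp hq (μ := μ) (by rw [hμ2]; ring)
  refine ⟨min ρ₁ ρ₂, lt_min hρ₁ hρ₂, (min_le_left _ _).trans hρ₁R,
    Or.inr ⟨s, |μ|, abs_pos.mpr hμ0, fun z hz => ?_⟩⟩
  have h1 := hP1 z (halfBall_mono (min_le_left _ _) hz)
  have h2 := hQ1 z (halfBall_mono (min_le_right _ _) hz)
  rw [hP0] at h1
  rw [hQ0] at h2
  have h3 := sq_add_sq_eq_of_exp (a := holoCoord f g e z) (b := holoCoord f g e' z) (w := Z z)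
    (p := (1 - κ) * r) (q := (1 + κ) * r) (μ := μ)
    (h1.trans (by ring_nf))
    (by rw [show holoCoord f g e z - Complex.I * holoCoord f g e' z = Q z by simp only [hQ]; ring,
      h2]; ring_nf)
  have hZre : (Z z).re = inner ℝ (f z) m := by simp [hZ, holoCoord, real_inner_comm]
  rw [hs, hZre] at h3
  rw [mem_catenoid_iff (abs_pos.mpr hμ0)]
  have h4 : (inner ℝ (f z - s • m) m : ℝ) = inner ℝ (f z) m - s := by
    rw [inner_sub_left, real_inner_smul_left, hm, mul_one]
  have h5 : f z - s • m - (inner ℝ (f z - s • m) m : ℝ) • m = f z - (inner ℝ (f z) m : ℝ) • m := by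
    rw [h4]; module
  rw [h5, norm_sub_axis_sq hm hee hme, h4, ← h3]
  simp [holoCoord, ← he']

end

/-! ### Charts at boundary points and continuation over the whole surface. -/

section

variable {M : Type*} [TopologicalSpace M] [ChartedSpace (EuclideanHalfSpace 2) M]

theorem exists_halfBall_subset_target (p : M) : ∃ R, 0 < R ∧
    halfBall (extChartAt (𝓡∂ 2) p p) R ⊆ (extChartAt (𝓡∂ 2) p).target := by
  have h := extChartAt_target_mem_nhdsWithin (I := 𝓡∂ 2) p
  obtain ⟨R, hR, h⟩ := Metric.mem_nhdsWithin_iff.mp h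
  rw [range_modelWithCornersEuclideanHalfSpace] at h
  exact ⟨R, hR, h⟩

theorem extChartAt_nonneg (p q : M) : 0 ≤ (extChartAt (𝓡∂ 2) p q) 0 := by
  have h : extChartAt (𝓡∂ 2) p q ∈ range (𝓡∂ 2) := mem_range_self _
  rwa [range_modelWithCornersEuclideanHalfSpace] at h

theorem eventually_extChartAt_mem_halfBall (p : M) {r : ℝ} (hr : 0 < r) :
    ∀ᶠ q in 𝓝 p, extChartAt (𝓡∂ 2) p q ∈ halfBall (extChartAt (𝓡∂ 2) p p) r ∧
      (extChartAt (𝓡∂ 2) p).symm (extChartAt (𝓡∂ 2) p q) = q := by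
  filter_upwards [(continuousAt_extChartAt (I := 𝓡∂ 2) p).eventually (Metric.ball_mem_nhds _ hr),
    extChartAt_source_mem_nhds (I := 𝓡∂ 2) p] with q h1 h2
  exact ⟨⟨h1, extChartAt_nonneg p q⟩, (extChartAt (𝓡∂ 2) p).left_inv h2⟩

variable [IsManifold (𝓡∂ 2) 2 M] {X : M → E3}

/-- The differential of a surface in a chart is the composition of its invariant differential with
an isomorphism. -/
theorem IsMinimalImmersion.exists_fderivWithin_eq (hX : IsMinimalImmersion X) (p : M) {R : ℝ}
    (hR : halfBall (extChartAt (𝓡∂ 2) p p) R ⊆ (extChartAt (𝓡∂ 2) p).target) {z : E2}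
    (hz : z ∈ halfBall (extChartAt (𝓡∂ 2) p p) R) : ∃ L : E2 ≃L[ℝ] E2, ∀ v,
      fderivWithin ℝ (X ∘ (extChartAt (𝓡∂ 2) p).symm) (halfBall (extChartAt (𝓡∂ 2) p p) R) z v =
        mfderiv (𝓡∂ 2) 𝓘(ℝ, E3) X ((extChartAt (𝓡∂ 2) p).symm z) (L v) := by
  have : IsManifold (𝓡∂ 2) 1 M := IsManifold.of_le (n := 2) (by norm_num)
  obtain ⟨L, hL⟩ := isInvertible_mfderivWithin_extChartAt_symm (I := 𝓡∂ 2) (hR hz)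
  refine ⟨L, fun v => ?_⟩
  have h1 : MDifferentiableAt (𝓡∂ 2) 𝓘(ℝ, E3) X ((extChartAt (𝓡∂ 2) p).symm z) :=
    hX.contMDiff.mdifferentiable (by norm_num) _
  have h2 := mdifferentiableWithinAt_extChartAt_symm (I := 𝓡∂ 2) (hR hz)
  have hu : UniqueMDiffWithinAt 𝓘(ℝ, E2) (range (𝓡∂ 2)) z :=
    ((𝓡∂ 2).uniqueDiffOn z (extChartAt_target_subset_range p (hR hz))).uniqueMDiffWithinAt
  have h3 := mfderiv_comp_mfderivWithin z h1 h2 hu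
  rw [mfderivWithin_eq_fderivWithin, ← hL] at h3
  have h4 : fderivWithin ℝ (X ∘ (extChartAt (𝓡∂ 2) p).symm)
      (halfBall (extChartAt (𝓡∂ 2) p p) R) z =
      fderivWithin ℝ (X ∘ (extChartAt (𝓡∂ 2) p).symm) (range (𝓡∂ 2)) z := by
    rw [range_modelWithCornersEuclideanHalfSpace, halfBall, inter_comm,
      fderivWithin_inter (Metric.isOpen_ball.mem_nhds hz.1)]
  rw [h4, h3]
  rfl

theorem IsMinimalImmersion.exists_isConjugate (hX : IsMinimalImmersion X) (p : M) {R : ℝ}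
    (hR0 : 0 < R) (hR : halfBall (extChartAt (𝓡∂ 2) p p) R ⊆ (extChartAt (𝓡∂ 2) p).target) :
    ∃ g N, IsConjugate (halfBall (extChartAt (𝓡∂ 2) p p) R)
      (X ∘ (extChartAt (𝓡∂ 2) p).symm) g N := by
  refine _root_.exists_isConjugate (convex_halfBall _ _)
    (nonempty_interior_halfBall (extChartAt_nonneg p p) hR0) ?_ ?_ ?_
  · rw [← contMDiffOn_iff_contDiffOn]
    exact (hX.contMDiff.comp_contMDiffOn (contMDiffOn_extChartAt_symm p)).mono hR
  · intro z hz
    obtain ⟨L, hL⟩ := hX.exists_fderivWithin_eq p hR hz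
    intro v w hvw
    rw [hL, hL] at hvw
    exact L.injective (hX.injective_mfderiv _ hvw)
  · intro z hz
    exact hX.meanCurvature_eq_zero (chartAt (EuclideanHalfSpace 2) p)
      (IsManifold.chart_mem_maximalAtlas p) z (interior_mono hR hz)

/-- Unique continuation: a connected minimal surface that satisfies an analytic relation near a
point satisfies it everywhere. -/
theorem IsMinimalImmersion.eq_zero_of_eventually_eq_zero [ConnectedSpace M]
    (hX : IsMinimalImmersion X) {F : E3 → ℝ} (hF : ∀ x, AnalyticAt ℝ F x) {p : M}
    (hp : ∀ᶠ q in 𝓝 p, F (X q) = 0) (q : M) : F (X q) = 0 := by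
  have hcl : IsClosed (interior {q | F (X q) = 0}) := by
    rw [← closure_subset_iff_isClosed]
    intro x hx
    obtain ⟨R, hR0, hR⟩ := exists_halfBall_subset_target x
    obtain ⟨g, N, h⟩ := hX.exists_isConjugate x hR0 hR
    have hev := eventually_extChartAt_mem_halfBall x hR0
    obtain ⟨y, ⟨hyS, hye⟩, hyA⟩ := mem_closure_iff_nhds.mp hx _ hev
    set e := extChartAt (𝓡∂ 2) x with he
    set S := halfBall (e x) R with hS
    have hec : ContinuousOn e.symm S := (continuousOn_extChartAt_symm x).mono hR
    have hne : (interior S).Nonempty := nonempty_interior_halfBall (extChartAt_nonneg x x) hR0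
    -- The point `y` may lie on the boundary of the surface; it is replaced by a nearby parameter
    -- `z₁` in the interior of the half disc, where continuation can start.
    have hycl : e y ∈ closure (interior S) := by
      rw [(convex_halfBall _ _).closure_interior_eq_closure_of_nonempty_interior hne]
      exact subset_closure hyS
    have hpre : e.symm ⁻¹' interior {q | F (X q) = 0} ∈ 𝓝[S] (e y) :=
      (hec (e y) hyS).preimage_mem_nhdsWithin (isOpen_interior.mem_nhds (by rwa [hye]))
    have hpre' := nhdsWithin_mono _ (interior_subset (s := S)) hpre
    have : (𝓝[interior S] (e y)).NeBot := mem_closure_iff_nhdsWithin_neBot.mp hycl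
    obtain ⟨z₁, hz₁, hz₁S⟩ := (inter_mem hpre' self_mem_nhdsWithin : _ ∈ 𝓝[interior S] (e y)) |>
      Filter.nonempty_of_mem
    have hz₁c : ContinuousAt e.symm z₁ :=
      hec.continuousAt (mem_interior_iff_mem_nhds.mp hz₁S)
    have hz₁ev : ∀ᶠ z in 𝓝 z₁, F ((X ∘ e.symm) z) = 0 :=
      (hz₁c.eventually (isOpen_interior.mem_nhds hz₁)).mono fun z hz =>
        interior_subset (s := {q | F (X q) = 0}) hz
    refine mem_interior_iff_mem_nhds.mpr (hev.mono fun w hw => ?_)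
    have := h.eq_zero_of_eventually_eq_zero (convex_halfBall _ _) hF hz₁S hz₁ev hw.1
    rwa [Function.comp_apply, hw.2] at this
  have huniv := IsClopen.eq_univ ⟨hcl, isOpen_interior⟩ ⟨p, mem_interior_iff_mem_nhds.mpr hp⟩
  exact interior_subset (s := {q | F (X q) = 0}) (huniv ▸ mem_univ q)

theorem extChartAt_symm_mem_boundary (p : M) {z : E2} (hz : z ∈ (extChartAt (𝓡∂ 2) p).target)
    (hz0 : z 0 = 0) : (extChartAt (𝓡∂ 2) p).symm z ∈ (𝓡∂ 2).boundary M := by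
  have hs : (extChartAt (𝓡∂ 2) p).symm z ∈ (chartAt (EuclideanHalfSpace 2) p).source := by
    rw [← extChartAt_source (𝓡∂ 2)]
    exact (extChartAt (𝓡∂ 2) p).map_target hz
  refine (ModelWithCorners.isBoundaryPoint_iff_of_mem_atlas (I := 𝓡∂ 2) (n := 2) (by norm_num)
    (chart_mem_atlas _ p) hs).mpr ?_
  change extChartAt (𝓡∂ 2) p ((extChartAt (𝓡∂ 2) p).symm z) ∈
    frontier (extChartAt (𝓡∂ 2) p).target
  rw [(extChartAt (𝓡∂ 2) p).right_inv hz]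
  refine ⟨subset_closure hz, fun h => ?_⟩
  have := interior_mono (extChartAt_target_subset_range p) h
  rw [interior_range_modelWithCornersEuclideanHalfSpace] at this
  exact (show 0 < z 0 from this).ne' hz0

/-- The flat side of the half disc is convex and its image consists of boundary points, so it stays
in the component of `p`. -/
theorem extChartAt_symm_mem_connectedComponentIn {p : M} {R : ℝ}
    (hR : halfBall (extChartAt (𝓡∂ 2) p p) R ⊆ (extChartAt (𝓡∂ 2) p).target) {z : E2}
    (hz : z ∈ halfBall (extChartAt (𝓡∂ 2) p p) R) (hz0 : z 0 = 0)
    (hp0 : (extChartAt (𝓡∂ 2) p p) 0 = 0) :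
    (extChartAt (𝓡∂ 2) p).symm z ∈ connectedComponentIn ((𝓡∂ 2).boundary M) p := by
  set e := extChartAt (𝓡∂ 2) p with he
  set T := halfBall (e p) R ∩ {w : E2 | w 0 = 0} with hT
  have hTe : T ⊆ e.target := inter_subset_left.trans hR
  have hpre : IsPreconnected (e.symm '' T) := (convex_halfBall_boundary _ _).isPreconnected.image _
    ((continuousOn_extChartAt_symm p).mono hTe)
  have hpT : p ∈ e.symm '' T := by
    refine ⟨e p, ⟨mem_halfBall_self hp0.ge ?_, hp0⟩, extChartAt_to_inv p⟩
    exact Metric.pos_of_mem_ball hz.1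
  refine hpre.subset_connectedComponentIn hpT ?_ (mem_image_of_mem _ ⟨hz, hz0⟩)
  rintro _ ⟨w, hw, rfl⟩
  exact extChartAt_symm_mem_boundary p (hTe hw) hw.2

end

/-! ### Analytic equations, planes and circles, and the conclusion. -/

theorem analyticAt_inner_sub (m c x : E3) : AnalyticAt ℝ (fun x => (inner ℝ m (x - c) : ℝ)) x := by
  have h : ContDiff ℝ ω (fun x : E3 => (inner ℝ m (x - c) : ℝ)) :=
    contDiff_const.inner ℝ (contDiff_id.sub contDiff_const)
  exact h.contDiffAt.analyticAt

theorem analyticAt_catenoid (a m : E3) (c : ℝ) (x : E3) :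
    AnalyticAt ℝ (fun x => ‖(x - a) - (inner ℝ (x - a) m : ℝ) • m‖ ^ 2 -
      (c * Real.cosh ((inner ℝ (x - a) m : ℝ) / c)) ^ 2) x := by
  have h1 : ContDiff ℝ ω (fun x : E3 => (inner ℝ (x - a) m : ℝ)) :=
    (contDiff_id.sub contDiff_const).inner ℝ contDiff_const
  have h2 : ContDiff ℝ ω (fun x : E3 => ‖(x - a) - (inner ℝ (x - a) m : ℝ) • m‖ ^ 2) :=
    ContDiff.norm_sq ℝ (by fun_prop)
  have h3 : ContDiff ℝ ω (fun x : E3 => (c * Real.cosh ((inner ℝ (x - a) m : ℝ) / c)) ^ 2) :=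
    (contDiff_const.mul (Real.contDiff_cosh.comp (h1.div_const c))).pow 2
  exact (h2.sub h3).contDiffAt.analyticAt

theorem isPlane_mk'_orthogonal {m : E3} (hm : m ≠ 0) (c : E3) :
    IsPlane (AffineSubspace.mk' c (Submodule.span ℝ {m})ᗮ) := by
  have : Fact (Module.finrank ℝ E3 = 2 + 1) := ⟨by simp⟩
  rw [IsPlane, AffineSubspace.direction_mk']
  exact Submodule.finrank_orthogonal_span_singleton hm

theorem IsPlane.exists_unit_normal {P : AffineSubspace ℝ E3} (hP : IsPlane P) :
    ∃ m ∈ P.directionᗮ, ‖m‖ = 1 := by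
  have h := Submodule.finrank_add_finrank_orthogonal P.direction
  rw [show Module.finrank ℝ P.direction = 2 from hP, finrank_euclideanSpace_fin] at h
  have h1 : P.directionᗮ ≠ ⊥ := by
    intro h0
    rw [h0, finrank_bot] at h
    omega
  obtain ⟨m, hm, hm0⟩ := Submodule.exists_mem_ne_zero_of_ne_bot h1
  exact ⟨‖m‖⁻¹ • m, Submodule.smul_mem _ _ hm, norm_smul_inv_norm hm0⟩

/-- Vectors from the centre of a circle are parallel to every plane that contains the circle. -/
theorem IsCircle.sub_center_mem_direction {P P' : AffineSubspace ℝ E3} {c : E3} {r : ℝ}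
    (hc : c ∈ P') (h : {x | x ∈ P' ∧ dist x c = r} ⊆ (P : Set E3)) {x : E3} (hx : x ∈ P')
    (hxr : dist x c = r) : x - c ∈ P.direction := by
  -- This is the antipode of `x` on the circle; half the chord between them is `x - c`.
  have h1 : AffineMap.lineMap x c (2 : ℝ) ∈ P :=
    h ⟨AffineMap.lineMap_mem _ hx hc, by
      rw [← hxr, dist_eq_norm, dist_eq_norm, ← norm_neg]
      congr 1
      rw [AffineMap.lineMap_apply]
      simp only [vsub_eq_sub, vadd_eq_add]
      module⟩
  have h2 := P.vsub_mem_direction (h ⟨hx, hxr⟩) h1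
  have h3 : x - c = (1 / 2 : ℝ) • (x -ᵥ AffineMap.lineMap x c (2 : ℝ)) := by
    rw [AffineMap.lineMap_apply]
    simp only [vsub_eq_sub, vadd_eq_add]
    module
  rw [h3]
  exact Submodule.smul_mem _ _ h2

theorem MakeAngle.inner_sq_eq {U V : Submodule ℝ E3} {θ : ℝ} (h : MakeAngle U V θ) {n m : E3}
    (hn : n ∈ Uᗮ) (hm : m ∈ Vᗮ) (hn1 : ‖n‖ = 1) (hm1 : ‖m‖ = 1) :
    inner ℝ n m ^ 2 = Real.cos θ ^ 2 := by
  have h1 : Real.cos (InnerProductGeometry.angle n m) = inner ℝ n m := by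
    rw [InnerProductGeometry.cos_angle, hn1, hm1]; simp
  rcases h n hn m hm (norm_ne_zero_iff.mp (by simp [hn1])) (norm_ne_zero_iff.mp (by simp [hm1]))
    with h2 | h2
  · rw [← h1, h2]
  · rw [← h1, h2, Real.cos_pi_sub, neg_sq]

theorem theorem1p2 {M : Type*} [TopologicalSpace M] [T2Space M] [SecondCountableTopology M]
    [ConnectedSpace M] [ChartedSpace (EuclideanHalfSpace 2) M] [IsManifold (𝓡∂ 2) 2 M]
    (X : M → E3) (hX : IsMinimalImmersion X)
    (hnonplanar : ¬ ∃ Q : AffineSubspace ℝ E3, IsPlane Q ∧ Set.range X ⊆ Q)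
    (Γ : Set M) (hΓ : IsBoundaryComponent Γ) (hcircle : IsCircle (X '' Γ))
    (P : AffineSubspace ℝ E3) (hP : IsPlane P) (hΓP : X '' Γ ⊆ P)
    (θ : ℝ) (hangle : ∀ p ∈ Γ, MakeAngle (tangentPlane X p) P.direction θ) :
    IsPartOfCatenoid (Set.range X) := by
  obtain ⟨p, hp, rfl⟩ := hΓ
  obtain ⟨P', -, c, hc, r, hr, hcirc⟩ := hcircle
  obtain ⟨m, hmP, hm1⟩ := hP.exists_unit_normal
  have hm : inner ℝ m m = (1 : ℝ) := by rw [real_inner_self_eq_norm_sq, hm1, one_pow]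
  have hm0 : m ≠ 0 := norm_ne_zero_iff.mp (by simp [hm1])
  have hp0 : (extChartAt (𝓡∂ 2) p p) 0 = 0 := by
    have h1 := (ModelWithCorners.isBoundaryPoint_iff (I := 𝓡∂ 2)).mp hp
    rw [frontier_range_modelWithCornersEuclideanHalfSpace] at h1
    exact (show (0 : ℝ) = (extChartAt (𝓡∂ 2) p p) 0 from h1).symm
  obtain ⟨R, hR0, hR⟩ := exists_halfBall_subset_target p
  obtain ⟨g, N, h⟩ := hX.exists_isConjugate p hR0 hR
  set e := extChartAt (𝓡∂ 2) p with he
  have hmem : e p ∈ halfBall (e p) R := mem_halfBall_self hp0.ge hR0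
  have harc : ∀ z ∈ halfBall (e p) R, z 0 = 0 →
      e.symm z ∈ connectedComponentIn ((𝓡∂ 2).boundary M) p := fun z hz hz0 =>
    extChartAt_symm_mem_connectedComponentIn hR hz hz0 hp0
  have hfcirc : ∀ z ∈ halfBall (e p) R, z 0 = 0 → X (e.symm z) ∈ P' ∧ dist (X (e.symm z)) c = r := by
    intro z hz hz0
    have h1 := mem_image_of_mem X (harc z hz hz0)
    rw [hcirc] at h1
    exact h1
  have hNm : ∀ z ∈ halfBall (e p) R, z 0 = 0 → inner ℝ (N z) m ^ 2 = Real.cos θ ^ 2 := by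
    intro z hz hz0
    refine (hangle _ (harc z hz hz0)).inner_sq_eq ?_ hmP ?_ hm1
    · rw [Submodule.mem_orthogonal']
      rintro _ ⟨u, rfl⟩
      obtain ⟨L, hL⟩ := hX.exists_fderivWithin_eq p hR hz
      obtain ⟨v, hv⟩ : ∃ v, L v = u := L.surjective u
      have h1 := h.inner_normal z hz v
      rw [hL, hv] at h1
      exact h1
    · have := h.inner_normal_self z hz
      rw [real_inner_self_eq_norm_sq] at this
      exact (pow_eq_one_iff_of_nonneg (norm_nonneg _) two_ne_zero).mp this
  set κ : ℝ := inner ℝ (N (e p)) m with hκ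
  have hNκ : ∀ z ∈ halfBall (e p) R, z 0 = 0 → inner ℝ (N z) m = κ := fun z hz hz0 =>
    (convex_halfBall_boundary (e p) R).isPreconnected.eq_of_sq_eq_const
      ((h.contDiffOn_normal.continuousOn.inner continuousOn_const).mono inter_subset_left)
      (fun w hw => hNm w hw.1 hw.2) ⟨hz, hz0⟩ ⟨hmem, hp0⟩
  -- Translation puts the centre at the origin; the constant of integration in the conjugate is
  -- chosen so that it equals `κ m × f` at the base point.
  have h' := h.sub_const c (g (e p) - κ • cross m ((X ∘ e.symm) (e p) - c))
  obtain ⟨ρ, hρ, -, hcase⟩ := h'.planar_or_catenoid_of_centered hp0 hR0 hm hr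
    (fun z hz hz0 => Submodule.inner_left_of_mem_orthogonal (IsCircle.sub_center_mem_direction hc
      (hcirc ▸ hΓP) (hfcirc z hz hz0).1 (hfcirc z hz hz0).2) hmP)
    (fun z hz hz0 => by
      rw [real_inner_self_eq_norm_sq, ← dist_eq_norm]
      rw [Function.comp_apply, (hfcirc z hz hz0).2])
    hNκ (by simp)
  -- An analytic equation that holds on the small half disc at `p` holds on a neighbourhood of `p`
  -- in the surface, hence on all of it.
  have hnear : ∀ {F : E3 → ℝ}, (∀ x, AnalyticAt ℝ F x) →
      (∀ z ∈ halfBall (e p) ρ, F ((X ∘ e.symm) z) = 0) → ∀ q, F (X q) = 0 := by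
    intro F hF hFz
    refine hX.eq_zero_of_eventually_eq_zero hF (p := p) ?_
    filter_upwards [eventually_extChartAt_mem_halfBall p hρ] with q hq
    have := hFz _ hq.1
    rwa [Function.comp_apply, hq.2] at this
  rcases hcase with hpl | ⟨s, c', hc', hcat⟩
  · refine absurd ⟨_, isPlane_mk'_orthogonal hm0 c, ?_⟩ hnonplanar
    rintro _ ⟨q, rfl⟩
    rw [SetLike.mem_coe, AffineSubspace.mem_mk', Submodule.mem_orthogonal_singleton_iff_inner_right]
    exact hnear (analyticAt_inner_sub m c) hpl q
  · refine ⟨c + s • m, m, c', hm1, hc', ?_⟩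
    rintro _ ⟨q, rfl⟩
    rw [mem_catenoid_iff hc']
    refine hnear (analyticAt_catenoid (c + s • m) m c') (fun z hz => ?_) q
    have h1 := (mem_catenoid_iff hc').mp (hcat z hz)
    rwa [show (X ∘ e.symm) z - c - s • m = (X ∘ e.symm) z - (c + s • m) from sub_sub _ _ _] at h1
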